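/- Let $G$ be a transitive permutation group of degree $11$ all of whose elements are even permutations, and let $\Gamma=(G,\{\rho_0,\ldots,\rho_{r-1}\})$ be a string C-group of rank $r\le 5$. That is: the $\rho_i$ are distinct involutions that generate $G$, $(\rho_i\rho_j)^2=1$ whenever $|i-j|>1$, and $\langle\rho_j : j\in J\rangle\cap\langle\rho_k : k\in K\rangle=\langle\rho_j : j\in J\cap K\rangle$ for all $J,K\subseteq\{0,\ldots,r-1\}$. The permutation representation graph $\mathcal G$ of $\Gamma$ is the edge-labelled multigraph on the $11$ points which has an $i$-edge $\{a,b\}$ whenever $\rho_i$ interchanges $a$ and $b$, $a\ne b$. Its dual is obtained by replacing each label $i$ by $r-1-i$. Put $G_i=\langle\rho_j : j\neq i\rangle$. A fracture graph (respectively, a $2$-fracture graph) of $\Gamma$ is a spanning subgraph of $\mathcal G$ that has, for each $i\in\{0,\ldots,r-1\}$, exactly one (respectively, exactly two) $i$-edges, each of them joining two vertices in different $G_i$-orbits. If $\Gamma$ has a fracture graph, then either $\Gamma$ has a $2$-fracture graph, or $r=4$ and, up to duality, $\mathcal G$ is isomorphic, as an edge-labelled graph, to the graph with vertices $v_0,\ldots,v_{10}$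 and edges - label $0$: $v_0v_1,\ v_4v_5,\ v_7v_8,\ v_9v_{10}$; - label $1$: $v_1v_2,\ v_3v_4,\ v_6v_7,\ v_9v_{10}$; - label $2$: $v_2v_3,\ v_4v_5,\ v_7v_9,\ v_8v_{10}$; - label $3$: $v_3v_6,\ v_4v_7,\ v_5v_8,\ v_9v_{10}$. -/

import Mathlib

namespace StringC

/-- `(G, {ρ 0, …, ρ (r-1)})` is a string group generated by involutions (an sggi) of rank `r`. -/
structure IsSGGI {M : Type*} [Group M] (G : Subgroup M) {r : ℕ} (ρ : Fin r → M) : Prop where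
  closure_eq : Subgroup.closure (Set.range ρ) = G
  injective : Function.Injective ρ
  involution : ∀ i, orderOf (ρ i) = 2
  commuting : ∀ i j : Fin r, 1 < |(i : ℤ) - (j : ℤ)| → (ρ i * ρ j) ^ 2 = 1

/-- The subgroup generated by the `ρ j` with `j ∈ J`. -/
def parabolic {M : Type*} [Group M] {r : ℕ} (ρ : Fin r → M) (J : Set (Fin r)) : Subgroup M :=
  Subgroup.closure (ρ '' J)

/-- The maximal parabolic subgroup `G_i`, generated by all `ρ j` with `j ≠ i`. -/
def maximalParabolic {M : Type*} [Group M] {r : ℕ} (ρ : Fin r → M) (i : Fin r) : Subgroup M :=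
  parabolic ρ {j | j ≠ i}

/-- A string C-group: an sggi with the intersection property. -/
structure IsStringCGroup {M : Type*} [Group M] (G : Subgroup M) {r : ℕ} (ρ : Fin r → M) : Prop
    extends IsSGGI G ρ where
  intersection : ∀ J K : Set (Fin r), parabolic ρ J ⊓ parabolic ρ K = parabolic ρ (J ∩ K)

/-- A multigraph on the vertex set `Ω` with edge labels `0, …, r-1`, in which edges with the same
label are never parallel: `𝒢 i` is the graph formed by the `i`-edges. Two edges with the same ends
and different labels are different edges. -/
abbrev LabelledGraph (r : ℕ) (Ω : Type*) := Fin r → SimpleGraph Ω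

namespace LabelledGraph

/-- The dual: the labels are reversed, `i ↦ r - 1 - i`. -/
def dual {r : ℕ} {Ω : Type*} (𝒢 : LabelledGraph r Ω) : LabelledGraph r Ω := fun i => 𝒢 i.rev

/-- Two labelled graphs with the same number of labels are isomorphic if a bijection of the
vertices maps the `i`-edges of one onto the `i`-edges of the other, for every label `i`. -/
def Isomorphic {r s : ℕ} {Ω Ω' : Type*} (𝒢 : LabelledGraph r Ω) (ℋ : LabelledGraph s Ω') : Prop :=
  ∃ (h : r = s) (σ : Ω ≃ Ω'), ∀ (i : Fin r) (a b : Ω),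
    (𝒢 i).Adj a b ↔ (ℋ (Fin.cast h i)).Adj (σ a) (σ b)

end LabelledGraph

/-- The permutation representation graph: `{a, b}` is an `i`-edge iff `ρ i` maps `a` to `b` and
`a ≠ b` (`fromRel` symmetrizes the relation, which changes nothing for an involution `ρ i`). -/
def permRepGraph {Ω : Type*} {r : ℕ} (ρ : Fin r → Equiv.Perm Ω) : LabelledGraph r Ω :=
  fun i => SimpleGraph.fromRel (fun a b => ρ i a = b)

/-- `F` is a spanning subgraph of the permutation representation graph which has, for every label
`i`, exactly `k` edges with label `i`, each of them joining vertices in different `G_i`-orbits.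
(If `k > 0` and there is such a subgraph, then every `G_i` is intransitive.) -/
def IsFractureGraphOfMultiplicity {Ω : Type*} {r : ℕ} (k : ℕ) (ρ : Fin r → Equiv.Perm Ω)
    (F : LabelledGraph r Ω) : Prop :=
  ∀ i : Fin r, F i ≤ permRepGraph ρ i ∧
    (∀ a b : Ω, (F i).Adj a b → a ∉ MulAction.orbit (maximalParabolic ρ i) b) ∧
    (F i).edgeSet.encard = k

/-- There is a fracture graph. -/
def HasFractureGraph {Ω : Type*} {r : ℕ} (ρ : Fin r → Equiv.Perm Ω) : Prop :=
  ∃ F : LabelledGraph r Ω, IsFractureGraphOfMultiplicity 1 ρ F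

/-- There is a 2-fracture graph. -/
def HasTwoFractureGraph {Ω : Type*} {r : ℕ} (ρ : Fin r → Equiv.Perm Ω) : Prop :=
  ∃ F : LabelledGraph r Ω, IsFractureGraphOfMultiplicity 2 ρ F

/-- The labelled graph
```
0 -0- 1 -1- 2 -2- 3 --1-- 4 =0,2= 5
                  |3      |3      |3
                  6 --1-- 7 --0-- 8
                          |2      |2
                          9 0,1,3 10
```
-/
def specialGraph : LabelledGraph 4 (Fin 11) :=
  ![SimpleGraph.fromEdgeSet {s(0, 1), s(4, 5), s(7, 8), s(9, 10)},
    SimpleGraph.fromEdgeSet {s(1, 2), s(3, 4), s(6, 7), s(9, 10)},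
    SimpleGraph.fromEdgeSet {s(2, 3), s(4, 5), s(7, 9), s(8, 10)},
    SimpleGraph.fromEdgeSet {s(3, 6), s(4, 7), s(5, 8), s(9, 10)}]

end StringC

/-!
Suppose that some label `i` does not have two `i`-edges that join different orbits of `G_i`; if
there is no such label, two edges chosen for each label form a 2-fracture graph. As there is a
fracture graph, exactly one `i`-edge `{a, b}` joins different orbits
(`HasFractureGraph.hasTwoFractureGraph_or`). Then `G_i` has exactly two orbits, because `G` is
transitive, and a generator `ρ_j` with `|i - j| > 1` fixes `a` and `b`, because it commutes with
`ρ_i` and therefore permutes the `i`-edges between the orbits. One of the orbits has at most 5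
points, by exchanging `a` and `b` it is that of `a`, and by passing to the dual `2 * i < r`.

What remains is a finite problem: all families of `r` involutions of 11 points, each moving 4 or 8
points as they are even, that commute where they have to and have such a splitting edge. These are
enumerated by a search in the style of coset enumeration. The points `a` and `b` are named 1
and 2; the images of the named points are guessed one after the other, a point without a name being
given the next free one, so that isomorphic representations are not listed again and again; and
partial tables that violate the conditions are given up. `search_sound` says that the search
meets the table of any given representation, so that a property checked for all its leaves holds
for every representation. The search itself is evaluated by the kernel
(`forall_searchFromStart_leafTest`).

The intersection property is not part of the conditions of the search; it is what excludes the
complete tables that the search finds. Each of them, except one, satisfies one of a list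
of relations `u ^ m = v ^ n` between words in the generators such that the common value does not
lie in the group generated by the letters common to `u` and `v`. There are at most two such
letters, so this group is trivial, generated by one involution, or dihedral, and elements outside
it are easily recognized (`notMem_closure_of_escapes`). The one remaining table has rank 4 and
describes the graph `specialGraph` (`isomorphic_specialGraph`).
-/

namespace StringC

namespace SplitSearch

open Equiv

/-! ### Tables of partial permutation representations, and their enumeration -/

/-- A table is a partial map from labels and names to names, packed into one natural number: the
entry for the label `j` at the name `x` is the nibble at bit `64 * j + 4 * x`. Names run from 1 to
11, and the entry 0 means that the image is not known. The operations are spelled as `Nat.land` and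
the like, and the recursions below with `cond` and recursors, because the kernel evaluates them
directly, without unfolding instances. -/
def entry (t j x : ℕ) : ℕ :=
  Nat.land (Nat.shiftRight t (Nat.add (Nat.mul 64 j) (Nat.mul 4 x))) 15

/-- The table `t` with the entry `y` written for the label `j` at the name `x`. As the bits are only
joined, this is meant for an entry which is still 0, or is `y` already. -/
def record (t j x y : ℕ) : ℕ :=
  Nat.lor t (Nat.shiftLeft y (Nat.add (Nat.mul 64 j) (Nat.mul 4 x)))

theorem testBit_entry (t j x k : ℕ) :
    (entry t j x).testBit k = (t.testBit (64 * j + 4 * x + k) && decide (k < 4)) := by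
  change ((t >>> (64 * j + 4 * x)) &&& (2 ^ 4 - 1)).testBit k = _
  rw [Nat.testBit_and, Nat.testBit_shiftRight, Nat.testBit_two_pow_sub_one]

theorem entry_record_self {t j x y : ℕ} (hy : y < 16) (h : entry t j x = 0 ∨ entry t j x = y) :
    entry (record t j x y) j x = y := by
  have key : entry (record t j x y) j x = entry t j x ||| y := by
    apply Nat.eq_of_testBit_eq
    intro k
    rw [Nat.testBit_or, testBit_entry, testBit_entry]
    change ((t ||| (y <<< (64 * j + 4 * x))).testBit _ && _) = _
    rw [Nat.testBit_or, Nat.testBit_shiftLeft]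
    have h1 : 64 * j + 4 * x + k - (64 * j + 4 * x) = k := by omega
    rw [h1]
    by_cases hk : k < 4
    · simp [hk]
    · have : y.testBit k = false :=
        Nat.testBit_lt_two_pow (lt_of_lt_of_le hy
          (by calc 16 = 2 ^ 4 := by norm_num
                _ ≤ 2 ^ k := Nat.pow_le_pow_right (by norm_num) (by omega)))
      simp [hk, this]
  rcases h with h | h <;> simp [key, h]

theorem entry_record_of_ne {t j x y j' x' : ℕ} (hy : y < 16) (hx : x < 16) (hx' : x' < 16)
    (hne : j' ≠ j ∨ x' ≠ x) : entry (record t j x y) j' x' = entry t j' x' := by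
  apply Nat.eq_of_testBit_eq
  intro k
  rw [testBit_entry, testBit_entry]
  change ((t ||| (y <<< (64 * j + 4 * x))).testBit _ && _) = _
  rw [Nat.testBit_or, Nat.testBit_shiftLeft]
  by_cases hk : k < 4
  · have : (decide (64 * j + 4 * x ≤ 64 * j' + 4 * x' + k) &&
        y.testBit (64 * j' + 4 * x' + k - (64 * j + 4 * x))) = false := by
      by_cases hle : 64 * j + 4 * x ≤ 64 * j' + 4 * x' + k
      · have : y.testBit (64 * j' + 4 * x' + k - (64 * j + 4 * x)) = false :=
          Nat.testBit_lt_two_pow (lt_of_lt_of_le hy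
            (by calc 16 = 2 ^ 4 := by norm_num
                  _ ≤ 2 ^ _ := Nat.pow_le_pow_right (by norm_num) (by omega)))
        simp [this]
      · simp [hle]
    simp [this]
  · simp [hk]

/-- All members of the list satisfy `q`; the evaluation stops at the first that does not. -/
def every (l : List ℕ) (q : ℕ → Bool) : Bool :=
  List.rec true (fun a _ ih => cond (q a) ih false) l

theorem every_iff {l : List ℕ} {q : ℕ → Bool} : every l q = true ↔ ∀ a ∈ l, q a = true := by
  induction l with
  | nil => simp [every]
  | cons a l ih =>
    change cond (q a) (every l q) false = true ↔ _
    cases h : q a <;> simp [h, ih]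

/-- The number of members of the list that satisfy `q`. -/
def tally (l : List ℕ) (q : ℕ → Bool) : ℕ :=
  List.rec 0 (fun a _ ih => cond (q a) (Nat.succ ih) ih) l

theorem tally_eq (l : List ℕ) (q : ℕ → Bool) : tally l q = (l.filter q).length := by
  induction l with
  | nil => rfl
  | cons a l ih =>
    change cond (q a) (Nat.succ (tally l q)) (tally l q) = _
    cases h : q a <;> simp [h, ih]

/-- The names that points may be given. -/
def names : List ℕ := [1, 2, 3, 4, 5, 6, 7, 8, 9, 10, 11]

theorem mem_names {v : ℕ} : v ∈ names ↔ 1 ≤ v ∧ v ≤ 11 := by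
  constructor
  · intro h
    simp only [names, List.mem_cons, List.not_mem_nil, or_false] at h
    omega
  · rintro ⟨h1, h2⟩
    interval_cases v <;> simp [names]

/-- The labels `0, …, r - 1`. -/
def labels (r : ℕ) : List ℕ := Nat.rec [] (fun k ih => k :: ih) r

theorem mem_labels {r j : ℕ} : j ∈ labels r ↔ j < r := by
  induction r with
  | zero => simp [labels]
  | succ r ih =>
    change j ∈ r :: labels r ↔ _
    rw [List.mem_cons, ih]
    omega

/-- Two entries agree if they are equal or one of them is not known. -/
def agree (x y : ℕ) : Bool := cond (Nat.beq x 0) true (cond (Nat.beq y 0) true (Nat.beq x y))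

theorem agree_of {x y : ℕ} (h : x ≠ 0 → y ≠ 0 → x = y) : agree x y = true := by
  unfold agree
  by_cases hx : x = 0
  · subst hx; rfl
  by_cases hy : y = 0
  · subst hy; cases Nat.beq x 0 <;> rfl
  · rw [h hx hy, Nat.beq_refl]
    cases Nat.beq y 0 <;> rfl

/-- Two labels are far apart if they differ by more than 1, so that their generators commute. -/
def far (j k : ℕ) : Bool := cond (Nat.blt (Nat.succ j) k) true (Nat.blt (Nat.succ k) j)

theorem far_iff {j k : ℕ} : far j k = true ↔ j + 1 < k ∨ k + 1 < j := by
  unfold far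
  by_cases h : j + 1 < k
  · have : Nat.blt (Nat.succ j) k = true := by simpa [Nat.blt_eq] using h
    simp [this, h]
  · have : Nat.blt (Nat.succ j) k = false := by
      rw [← Bool.not_eq_true, Nat.blt_eq]; exact h
    rw [this]
    simp [h, Nat.blt_eq]

/-- If the generator with label `j` interchanges `v` and `w`, then the known entries are compatible
with its commuting with the generators `k` far from `j`, as far as this concerns the square spanned
by the edge `v`, `w` and the `k`-edges at its ends. -/
def squaresAgree (r t j v w : ℕ) : Bool :=
  every (labels r) fun k => cond (far j k)
    (cond (agree (entry t j (entry t k v)) (entry t k w))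
      (cond (agree (entry t j (entry t k w)) (entry t k v))
        (cond (agree (entry t k (entry t j (entry t k v))) w)
          (agree (entry t k (entry t j (entry t k w))) v) false) false) false) true

/-- The number of names known to be moved by the label `j`. -/
def movedCount (t j : ℕ) : ℕ :=
  tally names fun v =>
    cond (Nat.beq (entry t j v) 0) false (cond (Nat.beq (entry t j v) v) false true)

/-- The number of names known to be fixed by the label `j`. -/
def fixedCount (t j : ℕ) : ℕ := tally names fun v => Nat.beq (entry t j v) v

/-- The known entries for the label `j` fit an involution that moves 4 or 8 of the 11 points: the
even involutions of degree 11. -/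
def rowAdmissible (t j : ℕ) : Bool :=
  cond (Nat.ble (fixedCount t j) 7)
    (cond (Nat.ble (movedCount t j) 4) true
      (cond (Nat.ble (movedCount t j) 8) (Nat.ble (fixedCount t j) 3) false)) false

/-- The bit of `s` at `v`. The sides are recorded such that a named point lies in the set `A` of a
split if and only if this bit is 0. -/
def side (s v : ℕ) : ℕ := Nat.land (Nat.shiftRight s v) 1

/-- The number of points named so far, out of `n`, that lie in `A`. -/
def smallSideCount (s n : ℕ) : ℕ :=
  tally names fun v => cond (Nat.blt n v) false (Nat.beq (side s v) 0)

/-- Not all points are named, but the images of all named points under all labels other than `i` are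
known. This is impossible, because the points named 1 and 2 represent all orbits of the generators
other than `i`. -/
def closedOff (r i t n : ℕ) : Bool :=
  cond (Nat.blt n 11)
    (every names fun v => cond (Nat.blt n v) true
      (every (labels r) fun j => cond (Nat.beq j i) true
        (cond (Nat.beq (entry t j v) 0) false true))) false

/-- Continue with the table `t`, into which the edge `v`, `w` with label `j` has just been written,
unless this table is contradictory. -/
def descend (r : ℕ) (next : ℕ → ℕ → ℕ → Bool) (j v w t n s : ℕ) : Bool :=
  cond (squaresAgree r t j v w) (cond (rowAdmissible t j) (next t n s) true) true

/-- Fill the slots (name, label) one by one, trying for each unknown image all free names on the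
same side and, if there are points without a name, the next new name; a new point is put on the side
of its neighbour, and at most 5 points on the side `A`. The arguments after the list are the table,
the number of names in use and the sides. A slot whose name is not in use yet can only be reached by
a contradictory table, and `closedOff` has to confirm this. The value is `true` if all such checks
succeed and the test `leaf` accepts every complete table that is reached. -/
def search (r i : ℕ) (leaf : ℕ → Bool) (slots : List (ℕ × ℕ)) : ℕ → ℕ → ℕ → Bool :=
  List.rec
    (fun t n _ => cond (Nat.beq n 11) (leaf t) false)
    (fun q _ next t n s =>
      cond (Nat.beq (entry t q.2 q.1) 0)
        (cond (Nat.blt n q.1) (closedOff r i t n)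
          (cond
            (every names fun w => cond (Nat.blt n w) true
              (cond (Nat.beq (entry t q.2 w) 0)
                (cond (Nat.beq (side s w) (side s q.1))
                  (descend r next q.2 q.1 w (record (record t q.2 q.1 w) q.2 w q.1) n s)
                  true) true))
            (cond (Nat.beq n 11) true
              (cond (Nat.ble
                  (smallSideCount (Nat.lor s (Nat.shiftLeft (side s q.1) (Nat.succ n)))
                    (Nat.succ n)) 5)
                (descend r next q.2 q.1 (Nat.succ n)
                  (record (record t q.2 q.1 (Nat.succ n)) q.2 (Nat.succ n) q.1) (Nat.succ n)
                  (Nat.lor s (Nat.shiftLeft (side s q.1) (Nat.succ n)))) true)) false))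
        (next t n s)) slots

/-- The slots in the order in which they are filled: all labels other than `i`, name by name, and
the label `i` last. -/
def slots (r i : ℕ) : List (ℕ × ℕ) :=
  (names.flatMap fun v => ((labels r).filter fun j => !Nat.beq j i).map fun j => (v, j)) ++
    names.map fun v => (v, i)

/-- The table at the start: the label `i` interchanges 1 and 2, and the labels far from `i` fix
both. -/
def start (r i : ℕ) : ℕ :=
  (labels r).foldr (fun j t => cond (far i j) (record (record t j 1 1) j 2 2) t)
    (record (record 0 i 1 2) i 2 1)

/-- The table `t` has exactly the entries expected at the start. -/
def startsRight (r i t : ℕ) : Bool :=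
  every (labels r) fun j => every (0 :: names) fun v =>
    Nat.beq (entry t j v)
      (cond (Nat.beq v 1) (cond (Nat.beq j i) 2 (cond (far i j) 1 0))
        (cond (Nat.beq v 2) (cond (Nat.beq j i) 1 (cond (far i j) 2 0)) 0))

/-- The whole search. The sides at the start, `4 = 2 ^ 2`, put the point named 1 in `A` and the
point named 2 outside. -/
def searchFromStart (r i : ℕ) (leaf : ℕ → Bool) : Bool :=
  cond (startsRight r i (start r i)) (search r i leaf (slots r i) (start r i) 2 4) false

/-! ### Splits, and the soundness of the enumeration -/

/-- The permutations `p 0, …, p (r-1)` are even involutions, those with labels far apart commute,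
and among the edges of the permutation representation graph only the `i`-edge from `a` to `b` joins
`A` and its complement. Moreover `a` and `b` together meet all orbits of the generators other than
`p i`, so these orbits are `A` and its complement. -/
structure IsSplit (p : ℕ → Perm (Fin 11)) (r i : ℕ) (a b : Fin 11) (A : Set (Fin 11)) :
    Prop where
  lt : i < r
  involutive : ∀ j < r, ∀ x, p j (p j x) = x
  commute : ∀ j < r, ∀ k < r, far j k = true → ∀ x, p j (p k x) = p k (p j x)
  support : ∀ j < r, (p j).support.card = 4 ∨ (p j).support.card = 8
  swap : p i a = b
  left_mem : a ∈ A
  right_notMem : b ∉ A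
  mem_iff : ∀ j < r, j ≠ i → ∀ x, p j x ∈ A ↔ x ∈ A
  mem_iff_of_ne : ∀ x, x ≠ a → x ≠ b → (p i x ∈ A ↔ x ∈ A)
  covers : ∀ S : Finset (Fin 11), a ∈ S → b ∈ S →
    (∀ j < r, j ≠ i → ∀ x ∈ S, p j x ∈ S) → S = Finset.univ

/-- A split of the 11 points whose part `A` is the smaller one. -/
structure IsSmallSplit (p : ℕ → Perm (Fin 11)) (r i : ℕ) (a b : Fin 11) (A : Set (Fin 11)) : Prop
    extends IsSplit p r i a b A where
  ncard_le : A.ncard ≤ 5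

section

variable {p : ℕ → Perm (Fin 11)} {r i : ℕ} {a b : Fin 11} {A : Set (Fin 11)}

theorem IsSplit.swap' (H : IsSplit p r i a b A) : p i b = a := by
  rw [← H.swap, H.involutive i H.lt]

/-- A generator that commutes with `p i` and moved `a` would carry the splitting edge to a second
edge joining `A` and its complement. -/
theorem IsSplit.fixes_left (H : IsSplit p r i a b A) {j : ℕ} (hj : j < r)
    (hf : far i j = true) : p j a = a := by
  have hji : j ≠ i := by
    rintro rfl
    rw [far_iff] at hf
    omega
  by_contra hne
  have hA : p j a ∈ A := (H.mem_iff j hj hji a).2 H.left_mem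
  have h1 := H.mem_iff_of_ne (p j a) hne (fun h => H.right_notMem (h ▸ hA))
  rw [H.commute i H.lt j hj hf, H.swap, H.mem_iff j hj hji] at h1
  exact H.right_notMem (h1.2 hA)

theorem IsSplit.fixes_right (H : IsSplit p r i a b A) {j : ℕ} (hj : j < r)
    (hf : far i j = true) : p j b = b := by
  rw [← H.swap, ← H.commute i H.lt j hj hf, H.fixes_left hj hf]

theorem IsSplit.symm (H : IsSplit p r i a b A) : IsSplit p r i b a Aᶜ where
  lt := H.lt
  involutive := H.involutive
  commute := H.commute
  support := H.support
  swap := H.swap'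
  left_mem := H.right_notMem
  right_notMem := fun h => h H.left_mem
  mem_iff j hj hji x := not_congr (H.mem_iff j hj hji x)
  mem_iff_of_ne x hb ha := not_congr (H.mem_iff_of_ne x ha hb)
  covers S hb ha := H.covers S ha hb

theorem IsSplit.exists_isSmallSplit (H : IsSplit p r i a b A) :
    ∃ a b A, IsSmallSplit p r i a b A := by
  have h := Set.ncard_add_ncard_compl A
  rw [Nat.card_eq_fintype_card, Fintype.card_fin] at h
  rcases Nat.lt_or_ge A.ncard 6 with h6 | h6
  · exact ⟨a, b, A, H, by omega⟩
  · exact ⟨b, a, Aᶜ, H.symm, by omega⟩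

/-- The table `t` records part of the action of the `p j` on the points `f 1, …, f n`, and `s`
records on which side of the split these points lie. The values of `f` at other names are of no
account. -/
structure Consistent (p : ℕ → Perm (Fin 11)) (r i : ℕ) (a b : Fin 11) (A : Set (Fin 11))
    (t n s : ℕ) (f : ℕ → Fin 11) : Prop where
  two_le : 2 ≤ n
  le : n ≤ 11
  inj : ∀ u v, 1 ≤ u → u ≤ n → 1 ≤ v → v ≤ n → f u = f v → u = v
  left : f 1 = a
  right : f 2 = b
  swap : entry t i 1 = 2
  swap' : entry t i 2 = 1
  side_iff : ∀ v, 1 ≤ v → v ≤ n → (side s v = 0 ↔ f v ∈ A)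
  side_eq_zero : ∀ v, n < v → side s v = 0
  entries : ∀ j < r, ∀ v ≤ 11, entry t j v ≠ 0 →
    1 ≤ v ∧ v ≤ n ∧ 1 ≤ entry t j v ∧ entry t j v ≤ n ∧ p j (f v) = f (entry t j v) ∧
      entry t j (entry t j v) = v

theorem side_eq_zero_iff {s v : ℕ} : side s v = 0 ↔ s.testBit v = false := by
  change (s >>> v) &&& 1 = 0 ↔ _
  rw [Nat.and_one_is_mod, Nat.shiftRight_eq_div_pow, Nat.testBit_eq_decide_div_mod_eq,
    decide_eq_false_iff_not]
  omega

theorem side_le_one (s v : ℕ) : side s v ≤ 1 := Nat.and_le_right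

theorem side_record {s v m u : ℕ} (hm : side s m = 0) :
    side (Nat.lor s (Nat.shiftLeft (side s v) m)) u = if u = m then side s v else side s u := by
  have hbit : (Nat.lor s (Nat.shiftLeft (side s v) m)).testBit u =
      (s.testBit u || (decide (m ≤ u) && (side s v).testBit (u - m))) := by
    change (s ||| (side s v <<< m)).testBit u = _
    rw [Nat.testBit_or, Nat.testBit_shiftLeft]
  have key : ∀ x y : ℕ, x ≤ 1 → y ≤ 1 → (x = 0 ↔ y = 0) → x = y := by omega
  refine key _ _ (side_le_one _ _) (by split_ifs <;> exact side_le_one _ _) ?_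
  rw [side_eq_zero_iff, hbit]
  rw [side_eq_zero_iff] at hm
  have h1 := side_le_one s v
  split_ifs with h
  · subst h
    rw [hm]
    interval_cases side s v <;> simp
  · rw [side_eq_zero_iff]
    rcases Nat.lt_or_ge u m with hlt | hge
    · simp [Nat.not_le.2 hlt]
    · have : (side s v).testBit (u - m) = false :=
        Nat.testBit_lt_two_pow (lt_of_le_of_lt h1 (Nat.one_lt_two_pow (by omega)))
      simp [this]

namespace Consistent

variable {t n s : ℕ} {f : ℕ → Fin 11}

theorem entry_zero (C : Consistent p r i a b A t n s f) {j : ℕ} (hj : j < r) :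
    entry t j 0 = 0 := by
  by_contra h
  have := (C.entries j hj 0 (by omega) h).1
  omega

theorem entry_le (C : Consistent p r i a b A t n s f) {j v : ℕ} (hj : j < r) (hv : v ≤ 11) :
    entry t j v ≤ 11 := by
  by_cases h : entry t j v = 0
  · omega
  · have := (C.entries j hj v hv h).2.2.2.1
    have := C.le
    omega

theorem apply (C : Consistent p r i a b A t n s f) {j v : ℕ} (hj : j < r) (hv : v ≤ 11)
    (h : entry t j v ≠ 0) : p j (f v) = f (entry t j v) :=
  (C.entries j hj v hv h).2.2.2.2.1

theorem ne_zero_of_entry (C : Consistent p r i a b A t n s f) {j v : ℕ} (hj : j < r)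
    (h : entry t j v ≠ 0) : v ≠ 0 := by
  rintro rfl
  exact h (C.entry_zero hj)

/-- If the image of a named point is a named point and the entry is known, then it is its name. -/
theorem entry_eq (C : Consistent p r i a b A t n s f) {j v w : ℕ} (hj : j < r) (hv : v ≤ 11)
    (h : entry t j v ≠ 0) (hw : 1 ≤ w) (hwn : w ≤ n) (he : p j (f v) = f w) :
    entry t j v = w := by
  have := C.entries j hj v hv h
  exact C.inj _ _ this.2.2.1 this.2.2.2.1 hw hwn (by rw [← this.2.2.2.2.1, he])

theorem squaresAgree (H : IsSmallSplit p r i a b A) (C : Consistent p r i a b A t n s f)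
    {j v w : ℕ} (hj : j < r) (hv1 : 1 ≤ v) (hvn : v ≤ n) (hw1 : 1 ≤ w) (hwn : w ≤ n)
    (hvw : p j (f v) = f w) : squaresAgree r t j v w = true := by
  have hn := C.le
  have hwv : p j (f w) = f v := by rw [← hvw, H.involutive j hj]
  rw [SplitSearch.squaresAgree, every_iff]
  intro k hk
  rw [mem_labels] at hk
  cases hfar : far j k with
  | false => rfl
  | true =>
    have hc := H.commute j hj k hk hfar
    -- Around the square spanned by the labels `j` and `k`, walked from `u` with `p j u = u'`.
    have two : ∀ u u', 1 ≤ u → u ≤ n → 1 ≤ u' → u' ≤ n → p j (f u) = f u' →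
        agree (entry t j (entry t k u)) (entry t k u') = true := by
      intro u u' _ hu _ hu' huu
      refine agree_of fun h1 h2 => ?_
      have h3 := C.ne_zero_of_entry hj h1
      have hb := C.entries k hk u' (by omega) h2
      refine C.entry_eq hj (C.entry_le hk (by omega)) h1 hb.2.2.1 hb.2.2.2.1 ?_
      rw [← C.apply hk (by omega) h3, hc, huu, C.apply hk (by omega) h2]
    have three : ∀ u u', 1 ≤ u → u ≤ n → 1 ≤ u' → u' ≤ n → p j (f u) = f u' →
        agree (entry t k (entry t j (entry t k u))) u' = true := by
      intro u u' _ hu hu1 hu' huu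
      refine agree_of fun h1 _ => ?_
      have h2 := C.ne_zero_of_entry hk h1
      have h3 := C.ne_zero_of_entry hj h2
      have h4 := C.entry_le (v := u) hk (by omega)
      refine C.entry_eq hk (C.entry_le hj h4) h1 hu1 hu' ?_
      rw [← C.apply hj h4 h2, ← C.apply hk (by omega) h3, hc, H.involutive k hk, huu]
    simp [two v w hv1 hvn hw1 hwn hvw, two w v hw1 hwn hv1 hvn hwv,
      three v w hv1 hvn hw1 hwn hvw, three w v hw1 hwn hv1 hvn hwv]

/-- Distinct names stand for distinct points. -/
theorem tally_names_le (C : Consistent p r i a b A t n s f) {q : ℕ → Bool}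
    {S : Finset (Fin 11)} (h : ∀ v, 1 ≤ v → v ≤ 11 → q v = true → v ≤ n ∧ f v ∈ S) :
    tally names q ≤ S.card := by
  have hnd : (names.filter q).Nodup := List.Nodup.filter _ (by decide)
  rw [tally_eq, ← List.toFinset_card_of_nodup hnd]
  have hmem : ∀ v ∈ (names.filter q).toFinset, 1 ≤ v ∧ v ≤ n ∧ f v ∈ S := by
    intro v hv
    rw [List.mem_toFinset, List.mem_filter, mem_names] at hv
    exact ⟨hv.1.1, h v hv.1.1 hv.1.2 hv.2⟩
  refine Finset.card_le_card_of_injOn f (fun v hv => (hmem v hv).2.2) ?_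
  intro u hu v hv huv
  exact C.inj u v (hmem u hu).1 (hmem u hu).2.1 (hmem v hv).1 (hmem v hv).2.1 huv

theorem rowAdmissible (H : IsSmallSplit p r i a b A) (C : Consistent p r i a b A t n s f)
    {j : ℕ} (hj : j < r) : rowAdmissible t j = true := by
  have hm : movedCount t j ≤ (p j).support.card := by
    refine C.tally_names_le fun v _ hv11 hq => ?_
    have h0 : entry t j v ≠ 0 := by
      intro h
      simp [h] at hq
    have hne : entry t j v ≠ v := by
      intro h
      rw [h] at hq
      simp at hq
    have he := C.entries j hj v hv11 h0
    refine ⟨he.2.1, Perm.mem_support.2 fun h => hne ?_⟩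
    exact C.entry_eq hj hv11 h0 he.1 he.2.1 h
  have hf : fixedCount t j ≤ (p j).supportᶜ.card := by
    refine C.tally_names_le fun v hv1 hv11 hq => ?_
    have hq' : entry t j v = v := Nat.eq_of_beq_eq_true hq
    have h0 : entry t j v ≠ 0 := by omega
    have he := C.entries j hj v hv11 h0
    refine ⟨he.2.1, ?_⟩
    rw [Finset.mem_compl, Perm.notMem_support, he.2.2.2.2.1, hq']
  rw [Finset.card_compl, Fintype.card_fin] at hf
  have b1 : ∀ x y, x ≤ y → Nat.ble x y = true := fun x y h => Nat.ble_eq_true_of_le h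
  unfold SplitSearch.rowAdmissible
  rcases H.support j hj with h | h
  · rw [b1 _ 7 (by omega), b1 _ 4 (by omega)]; rfl
  · rw [b1 _ 7 (by omega), b1 (movedCount t j) 8 (by omega), b1 _ 3 (by omega)]
    cases Nat.ble (movedCount t j) 4 <;> rfl

theorem closedOff_eq_false (H : IsSmallSplit p r i a b A)
    (C : Consistent p r i a b A t n s f) : closedOff r i t n = false := by
  rw [← Bool.not_eq_true]
  intro h
  unfold closedOff at h
  have hlt : n < 11 := by
    by_contra hge
    have : Nat.blt n 11 = false := by rw [← Bool.not_eq_true, Nat.blt_eq]; exact hge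
    simp [this] at h
  have hb : Nat.blt n 11 = true := by rw [Nat.blt_eq]; exact hlt
  rw [hb, cond_true, every_iff] at h
  have h2 := C.two_le
  have hcl := H.covers ((Finset.Icc 1 n).image f)
    (Finset.mem_image.2 ⟨1, Finset.mem_Icc.2 ⟨by omega, by omega⟩, C.left⟩)
    (Finset.mem_image.2 ⟨2, Finset.mem_Icc.2 ⟨by omega, by omega⟩, C.right⟩) (by
      intro j hj hji x hx
      obtain ⟨v, hv, rfl⟩ := Finset.mem_image.1 hx
      rw [Finset.mem_Icc] at hv
      have h3 := h v (mem_names.2 ⟨hv.1, by omega⟩)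
      have hnv : Nat.blt n v = false := by rw [← Bool.not_eq_true, Nat.blt_eq]; omega
      rw [hnv, cond_false, every_iff] at h3
      have h4 := h3 j (mem_labels.2 hj)
      have h5 : Nat.beq j i = false := by
        rw [← Bool.not_eq_true, Nat.beq_eq]; exact hji
      rw [h5, cond_false] at h4
      have h0 : entry t j v ≠ 0 := by
        intro h0
        simp [h0] at h4
      have he := C.entries j hj v (by omega) h0
      exact Finset.mem_image.2 ⟨entry t j v, Finset.mem_Icc.2 ⟨he.2.2.1, he.2.2.2.1⟩,
        he.2.2.2.2.1.symm⟩)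
  have hc : ((Finset.Icc 1 n).image f).card ≤ n := by
    simpa using Finset.card_image_le (s := Finset.Icc 1 n) (f := f)
  rw [hcl, Finset.card_univ, Fintype.card_fin] at hc
  omega

/-- An edge between two named points may be written into the table. -/
theorem recordEdge (H : IsSmallSplit p r i a b A) (C : Consistent p r i a b A t n s f)
    {j v w : ℕ} (hj : j < r) (hv1 : 1 ≤ v) (hvn : v ≤ n) (hw1 : 1 ≤ w) (hwn : w ≤ n)
    (hv : entry t j v = 0) (hw : entry t j w = 0) (hvw : p j (f v) = f w) :
    Consistent p r i a b A (record (record t j v w) j w v) n s f := by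
  have hn := C.le
  have hwv : p j (f w) = f v := by rw [← hvw, H.involutive j hj]
  have e1 : entry (record (record t j v w) j w v) j v = w := by
    by_cases h : v = w
    · subst h
      exact entry_record_self (by omega) (Or.inr (entry_record_self (by omega) (Or.inl hv)))
    · rw [entry_record_of_ne (by omega) (by omega) (by omega) (Or.inr h)]
      exact entry_record_self (by omega) (Or.inl hv)
  have e2 : entry (record (record t j v w) j w v) j w = v := by
    by_cases h : v = w
    · subst h; exact e1
    · refine entry_record_self (by omega) (Or.inl ?_)
      rw [entry_record_of_ne (by omega) (by omega) (by omega) (Or.inr (Ne.symm h)), hw]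
  have e3 : ∀ k x, x < 16 → (k ≠ j ∨ (x ≠ v ∧ x ≠ w)) →
      entry (record (record t j v w) j w v) k x = entry t k x := by
    intro k x hx h
    rw [entry_record_of_ne (by omega) (by omega) hx (by tauto),
      entry_record_of_ne (by omega) (by omega) hx (by tauto)]
  have old : ∀ k x, x < 16 → entry t k x ≠ 0 →
      entry (record (record t j v w) j w v) k x = entry t k x := by
    intro k x hx h
    refine e3 k x hx ?_
    by_contra hcon
    push Not at hcon
    obtain ⟨rfl, h2⟩ := hcon
    by_cases hxv : x = v
    · exact h (hxv ▸ hv)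
    · exact h (h2 hxv ▸ hw)
  refine ⟨C.two_le, C.le, C.inj, C.left, C.right, ?_, ?_, C.side_iff, C.side_eq_zero, ?_⟩
  · rw [old i 1 (by omega) (by rw [C.swap]; omega), C.swap]
  · rw [old i 2 (by omega) (by rw [C.swap']; omega), C.swap']
  · intro k hk x hx hne
    by_cases hkv : k = j ∧ x = v
    · obtain ⟨rfl, rfl⟩ := hkv
      rw [e1]
      exact ⟨hv1, hvn, hw1, hwn, hvw, e2⟩
    by_cases hkw : k = j ∧ x = w
    · obtain ⟨rfl, rfl⟩ := hkw
      rw [e2]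
      exact ⟨hw1, hwn, hv1, hvn, hwv, e1⟩
    have h3 := e3 k x (by omega) (by tauto)
    rw [h3] at hne ⊢
    have he := C.entries k hk x hx hne
    refine ⟨he.1, he.2.1, he.2.2.1, he.2.2.2.1, he.2.2.2.2.1, ?_⟩
    rw [old k _ (by omega) (by rw [he.2.2.2.2.2]; omega), he.2.2.2.2.2]

/-- A point without a name may be given the next one. -/
theorem addName (C : Consistent p r i a b A t n s f) (hn : n < 11) {y : Fin 11} {v : ℕ}
    (hv1 : 1 ≤ v) (hvn : v ≤ n)
    (hy : ∀ w, 1 ≤ w → w ≤ n → f w ≠ y) (hside : y ∈ A ↔ f v ∈ A) :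
    Consistent p r i a b A t (n + 1) (Nat.lor s (Nat.shiftLeft (side s v) (n + 1)))
      (Function.update f (n + 1) y) := by
  have h2 := C.two_le
  have hold : ∀ u, u ≤ n → Function.update f (n + 1) y u = f u := fun u hu =>
    Function.update_of_ne (by omega) _ _
  have hnew : Function.update f (n + 1) y (n + 1) = y := Function.update_self _ _ _
  have hs : ∀ u, side (Nat.lor s (Nat.shiftLeft (side s v) (n + 1))) u =
      if u = n + 1 then side s v else side s u := fun u =>
    side_record (C.side_eq_zero _ (by omega))
  refine ⟨by omega, by omega, ?_, ?_, ?_, C.swap, C.swap', ?_, ?_, ?_⟩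
  · intro u w hu1 hun hw1 hwn huw
    rcases Nat.lt_or_ge n u with hu | hu <;> rcases Nat.lt_or_ge n w with hw | hw
    · omega
    · obtain rfl : u = n + 1 := by omega
      rw [hnew, hold w hw] at huw
      exact absurd huw.symm (hy w hw1 hw)
    · obtain rfl : w = n + 1 := by omega
      rw [hnew, hold u hu] at huw
      exact absurd huw (hy u hu1 hu)
    · rw [hold u hu, hold w hw] at huw
      exact C.inj u w hu1 hu hw1 hw huw
  · rw [hold 1 (by omega), C.left]
  · rw [hold 2 (by omega), C.right]
  · intro u hu1 hun
    rw [hs]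
    split_ifs with h
    · rw [h, hnew, C.side_iff v hv1 hvn, hside]
    · rw [hold u (by omega), C.side_iff u hu1 (by omega)]
  · intro u hu
    rw [hs, if_neg (by omega)]
    exact C.side_eq_zero u (by omega)
  · intro j hj u hu hne
    have he := C.entries j hj u hu hne
    rw [hold u he.2.1, hold _ he.2.2.2.1]
    exact ⟨he.1, by omega, he.2.2.1, by omega, he.2.2.2.2⟩

theorem smallSideCount_le (H : IsSmallSplit p r i a b A) (C : Consistent p r i a b A t n s f) :
    smallSideCount s n ≤ 5 := by
  classical
  refine le_trans ?_ H.ncard_le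
  rw [Set.ncard_eq_toFinset_card' A]
  refine C.tally_names_le fun v hv1 _ hq => ?_
  have hvn : v ≤ n := by
    by_contra hlt
    have : Nat.blt n v = true := by rw [Nat.blt_eq]; omega
    simp [this] at hq
  have hnv : Nat.blt n v = false := by rw [← Bool.not_eq_true, Nat.blt_eq]; omega
  rw [hnv, cond_false] at hq
  exact ⟨hvn, by simpa using (C.side_iff v hv1 hvn).1 (Nat.eq_of_beq_eq_true hq)⟩

theorem of_startsRight (H : IsSmallSplit p r i a b A) {t : ℕ} (h : startsRight r i t = true) :
    Consistent p r i a b A t 2 4 (fun v => if v = 1 then a else b) := by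
  have hab : a ≠ b := fun h => H.right_notMem (h ▸ H.left_mem)
  have hstart : ∀ j < r, ∀ v ≤ 11, entry t j v =
      if v = 1 then (if j = i then 2 else if far i j = true then 1 else 0)
      else if v = 2 then (if j = i then 1 else if far i j = true then 2 else 0) else 0 := by
    intro j hj v hv
    rw [startsRight, every_iff] at h
    have h1 := h j (mem_labels.2 hj)
    rw [every_iff] at h1
    have h2 : v ∈ 0 :: names := by
      rcases Nat.eq_zero_or_pos v with h0 | h0
      · simp [h0]
      · exact List.mem_cons_of_mem _ (mem_names.2 ⟨h0, hv⟩)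
    have h3 := Nat.eq_of_beq_eq_true (h1 v h2)
    rw [h3]
    simp only [Bool.cond_eq_ite, Nat.beq_eq]
  refine ⟨le_rfl, by omega, ?_, rfl, rfl, ?_, ?_, ?_, ?_, ?_⟩
  · intro u v hu1 hu2 hv1 hv2 huv
    interval_cases u <;> interval_cases v <;> simp_all
  · rw [hstart i H.lt 1 (by omega)]; simp
  · rw [hstart i H.lt 2 (by omega)]; simp
  · intro v hv1 hv2
    interval_cases v
    · simp only [if_true, H.left_mem, iff_true]; rfl
    · simp only [OfNat.ofNat_ne_one, if_false, H.right_notMem, iff_false]; decide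
  · intro v hv
    rw [side_eq_zero_iff]
    exact Nat.testBit_lt_two_pow (x := 4) (lt_of_lt_of_le (by norm_num)
      (Nat.pow_le_pow_right (n := 2) (by norm_num) (show 3 ≤ v by omega)))
  · intro j hj v hv hne
    have e1 := hstart j hj 1 (by omega)
    have e2 := hstart j hj 2 (by omega)
    have e := hstart j hj v hv
    have hff : far i i = false := by
      rw [← Bool.not_eq_true, far_iff]; omega
    by_cases hv1 : v = 1
    · subst hv1
      by_cases hji : j = i
      · subst hji
        simp [e1, e2, H.swap]
      · by_cases hf : far i j = true
        · simp [e1, hji, hf, H.fixes_left hj hf]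
        · simp [e1, hji, hf] at hne
    by_cases hv2 : v = 2
    · subst hv2
      by_cases hji : j = i
      · subst hji
        simp [e1, e2, H.swap']
      · by_cases hf : far i j = true
        · simp [e2, hji, hf, H.fixes_right hj hf]
        · simp [e2, hji, hf] at hne
    · simp [hv1, hv2] at e
      exact absurd e hne

end Consistent

/-- The search does not miss the table of a given representation: one branch at every slot stays
consistent with it, until a complete table for it is handed to `leaf`. -/
theorem search_sound (H : IsSmallSplit p r i a b A) {leaf : ℕ → Bool} {P : Prop}
    (hleaf : ∀ t s f, Consistent p r i a b A t 11 s f → leaf t = true → P)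
    (l : List (ℕ × ℕ)) (hl : ∀ q ∈ l, 1 ≤ q.1 ∧ q.1 ≤ 11 ∧ q.2 < r) :
    ∀ t n s f, Consistent p r i a b A t n s f → search r i leaf l t n s = true → P := by
  induction l with
  | nil =>
    intro t n s f C h
    change cond (Nat.beq n 11) (leaf t) false = true at h
    cases hn : Nat.beq n 11 with
    | false => simp [hn] at h
    | true =>
      obtain rfl := Nat.eq_of_beq_eq_true hn
      exact hleaf t s f C (by simpa [hn] using h)
  | cons q l ih =>
    obtain ⟨v, j⟩ := q
    have ih' := ih fun q hq => hl q (List.mem_cons_of_mem _ hq)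
    obtain ⟨hv1, hv11, hj⟩ := hl (v, j) List.mem_cons_self
    intro t n s f C h
    change cond (Nat.beq (entry t j v) 0)
        (cond (Nat.blt n v) (closedOff r i t n)
          (cond
            (every names fun w => cond (Nat.blt n w) true
              (cond (Nat.beq (entry t j w) 0)
                (cond (Nat.beq (side s w) (side s v))
                  (descend r (search r i leaf l) j v w (record (record t j v w) j w v) n s)
                  true) true))
            (cond (Nat.beq n 11) true
              (cond (Nat.ble
                  (smallSideCount (Nat.lor s (Nat.shiftLeft (side s v) (Nat.succ n)))
                    (Nat.succ n)) 5)
                (descend r (search r i leaf l) j v (Nat.succ n)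
                  (record (record t j v (Nat.succ n)) j (Nat.succ n) v) (Nat.succ n)
                  (Nat.lor s (Nat.shiftLeft (side s v) (Nat.succ n)))) true)) false))
        (search r i leaf l t n s) = true at h
    cases h0 : Nat.beq (entry t j v) 0 with
    | false =>
      rw [h0] at h
      exact ih' t n s f C h
    | true =>
      have hv0 := Nat.eq_of_beq_eq_true h0
      rw [h0, cond_true] at h
      cases hnv : Nat.blt n v with
      | true =>
        rw [hnv, cond_true, C.closedOff_eq_false H] at h
        exact absurd h Bool.false_ne_true
      | false =>
        have hvn : v ≤ n := by
          rw [← Bool.not_eq_true, Nat.blt_eq] at hnv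
          omega
        rw [hnv, cond_false] at h
        have hback : ∀ w, p j (f v) = f w → p j (f w) = f v := fun w hw => by
          rw [← hw, H.involutive j hj]
        -- The neighbour of a point lies on its own side, because the slots of the
        -- splitting edge are filled from the start.
        have hmem : p j (f v) ∈ A ↔ f v ∈ A := by
          by_cases hji : j = i
          · subst hji
            have := C.two_le
            refine H.mem_iff_of_ne _ (fun hva => ?_) (fun hvb => ?_)
            · have : v = 1 := C.inj v 1 hv1 hvn le_rfl (by omega) (by rw [hva, C.left])
              rw [this, C.swap] at hv0
              omega
            · have : v = 2 := C.inj v 2 hv1 hvn (by omega) (by omega) (by rw [hvb, C.right])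
              rw [this, C.swap'] at hv0
              omega
          · exact H.mem_iff j hj hji _
        have hdesc : ∀ w t' n' s' f', Consistent p r i a b A t' n' s' f' → v ≤ n' → 1 ≤ w →
            w ≤ n' → p j (f' v) = f' w →
            descend r (search r i leaf l) j v w t' n' s' = true → P := by
          intro w t' n' s' f' C' hvn' hw1 hwn' hvw hd
          rw [descend, C'.squaresAgree H hj hv1 hvn' hw1 hwn' hvw, C'.rowAdmissible H hj] at hd
          exact ih' t' n' s' f' C' hd
        have hpair : ∀ x y : Bool, cond x y false = true → x = true ∧ y = true := by decide
        obtain ⟨hall, hnext⟩ := hpair _ _ h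
        by_cases hex : ∃ w, 1 ≤ w ∧ w ≤ n ∧ f w = p j (f v)
        · obtain ⟨w, hw1, hwn, hw⟩ := hex
          have hle := C.le
          rw [every_iff] at hall
          have h1 := hall w (mem_names.2 ⟨hw1, by omega⟩)
          have hnw : Nat.blt n w = false := by
            rw [← Bool.not_eq_true, Nat.blt_eq]; omega
          have hw0 : entry t j w = 0 := by
            by_contra hne
            have he := C.entries j hj w (by omega) hne
            have : entry t j w = v :=
              C.entry_eq hj (by omega) hne hv1 hvn (hback w hw.symm)
            rw [this] at he
            rw [he.2.2.2.2.2] at hv0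
            omega
          have hside : side s w = side s v := by
            have h2 := C.side_iff v hv1 hvn
            have h3 := C.side_iff w hw1 hwn
            rw [hw, hmem, ← h2] at h3
            have := side_le_one s w
            have := side_le_one s v
            omega
          rw [hnw, cond_false, hw0, Nat.beq_refl, cond_true, hside, Nat.beq_refl,
            cond_true] at h1
          exact hdesc w _ n s f (C.recordEdge H hj hv1 hvn hw1 hwn hv0 hw0 hw.symm)
            hvn hw1 hwn hw.symm h1
        · push Not at hex
          have hlt : n < 11 := by
            by_contra hge
            have hn : n = 11 := by have := C.le; omega
            subst hn
            have himg : (Finset.Icc 1 11).image f = Finset.univ := by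
              apply Finset.eq_univ_of_card
              rw [Finset.card_image_of_injOn, Nat.card_Icc, Fintype.card_fin]
              intro u hu w hw huw
              rw [Finset.mem_coe, Finset.mem_Icc] at hu hw
              exact C.inj u w hu.1 hu.2 hw.1 hw.2 huw
            obtain ⟨w, hw, hw'⟩ := Finset.mem_image.1 (himg ▸ Finset.mem_univ (p j (f v)))
            rw [Finset.mem_Icc] at hw
            exact hex w hw.1 hw.2 hw'
          have hn11 : Nat.beq n 11 = false := by
            rw [← Bool.not_eq_true, Nat.beq_eq]; omega
          rw [hn11, cond_false] at hnext
          have C' := C.addName hlt hv1 hvn hex hmem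
          have hsmall := C'.smallSideCount_le H
          rw [Nat.ble_eq_true_of_le hsmall, cond_true] at hnext
          have hfv : Function.update f (n + 1) (p j (f v)) v = f v :=
            Function.update_of_ne (by omega) _ _
          have hfn : Function.update f (n + 1) (p j (f v)) (n + 1) = p j (f v) :=
            Function.update_self _ _ _
          have hvw : p j (Function.update f (n + 1) (p j (f v)) v) =
              Function.update f (n + 1) (p j (f v)) (n + 1) := by rw [hfv, hfn]
          have hn0 : entry t j (n + 1) = 0 := by
            by_contra hne
            have := (C.entries j hj (n + 1) (by omega) hne).2.1
            omega
          exact hdesc (n + 1) _ (n + 1) _ _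
            (C'.recordEdge H hj hv1 (by omega) (by omega) le_rfl hv0 hn0 hvw)
            (by omega) (by omega) le_rfl hvw hnext

theorem searchFromStart_sound (H : IsSmallSplit p r i a b A) {leaf : ℕ → Bool} {P : Prop}
    (hleaf : ∀ t s f, Consistent p r i a b A t 11 s f → leaf t = true → P)
    (h : searchFromStart r i leaf = true) : P := by
  unfold searchFromStart at h
  cases h1 : startsRight r i (start r i) with
  | false => simp [h1] at h
  | true =>
    rw [h1] at h
    refine search_sound H hleaf (slots r i) ?_ _ _ _ _ (Consistent.of_startsRight H h1) h
    intro q hq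
    rw [slots, List.mem_append, List.mem_flatMap, List.mem_map] at hq
    rcases hq with ⟨v, hv, hq⟩ | ⟨v, hv, rfl⟩
    · obtain ⟨j, hj, rfl⟩ := List.mem_map.1 hq
      exact ⟨(mem_names.1 hv).1, (mem_names.1 hv).2, mem_labels.1 (List.mem_filter.1 hj).1⟩
    · exact ⟨(mem_names.1 hv).1, (mem_names.1 hv).2, H.lt⟩

end

/-! ### Relations that violate the intersection property -/

/-- The image of `x` under the product of the generators with the labels in `u`, the last letter
acting first; 0 if it is not known. -/
def wordValue (t : ℕ) (u : List ℕ) (x : ℕ) : ℕ := List.rec x (fun j _ ih => entry t j ih) u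

/-- The image of `x` under the `m`-th power of the word `u`; 0 if it is not known. -/
def powerValue (t : ℕ) (u : List ℕ) (m x : ℕ) : ℕ := Nat.rec x (fun _ ih => wordValue t u ih) m

/-- A relation `left ^ leftExp = right ^ rightExp` between powers of words in the labels. -/
structure Relation where
  left : List ℕ
  leftExp : ℕ
  right : List ℕ
  rightExp : ℕ

/-- The maps `g` and `h` agree, with known values, at all names. -/
def sameOnNames (g h : ℕ → ℕ) : Bool :=
  every names fun x => cond (Nat.beq (g x) 0) false (Nat.beq (g x) (h x))

/-- The maps `g` and `h` have different known values at some name. -/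
def differOnNames (g h : ℕ → ℕ) : Bool :=
  names.any fun x => !Nat.beq (g x) 0 && (!Nat.beq (h x) 0 && !Nat.beq (g x) (h x))

/-- The labels that occur in both words. -/
def commonLetters (r : ℕ) (u v : List ℕ) : List ℕ :=
  (labels r).filter fun j => decide (j ∈ u) && decide (j ∈ v)

/-- The permutation computed by `g` is not in the group generated by the listed labels. For two
labels `c` and `d` it suffices that it conjugates the product `c * d` neither to itself nor to its
inverse `d * c`. Longer lists are not treated. -/
def escapes (t : ℕ) (g : ℕ → ℕ) : List ℕ → Bool
  | [] => differOnNames g id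
  | [c] => differOnNames g id && differOnNames g (entry t c)
  | [c, d] =>
    differOnNames (fun x => g (entry t c (entry t d x))) (fun x => entry t c (entry t d (g x))) &&
    differOnNames (fun x => g (entry t c (entry t d x))) (fun x => entry t d (entry t c (g x)))
  | _ => false

/-- The relation holds in the table `t`, but the common value of its two sides is not in the group
generated by the common letters. This contradicts the intersection property. -/
def Relation.refutes (R : Relation) (r t : ℕ) : Bool :=
  cond (sameOnNames (powerValue t R.left R.leftExp) (powerValue t R.right R.rightExp))
    (every R.left (fun j => Nat.blt j r) && (every R.right (fun j => Nat.blt j r) &&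
      escapes t (powerValue t R.left R.leftExp) (commonLetters r R.left R.right))) false

/-- For every complete table that the search reaches, except `specialTable`, one of these relations
violates the intersection property. -/
def relations : List Relation :=
  [⟨[1, 0, 1, 0, 1, 0], 2, [3], 1⟩,
   ⟨[0, 2, 1, 0, 1, 0, 1, 0, 1, 0, 2], 1, [2, 1, 2, 3, 2, 3, 2, 3], 5⟩,
   ⟨[0, 1], 7, [3], 1⟩,
   ⟨[0, 1, 0, 1, 0, 1, 0, 1, 0, 1], 2, [3], 1⟩,
   ⟨[0, 1, 2], 7, [3, 2, 3, 2, 3, 2, 1, 2], 4⟩,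
   ⟨[0, 1, 0, 1, 0, 1, 0, 1, 0], 1, [1, 2, 3, 2, 3, 2, 3, 2], 3⟩,
   ⟨[1, 0, 1], 1, [1, 3, 2, 3, 2, 1, 4], 5⟩,
   ⟨[2, 1, 3, 2, 1, 2, 3, 2, 1, 2, 1, 3], 3, [3, 2, 3, 4, 3, 2, 3, 2], 5⟩,
   ⟨[1, 2, 1, 0, 1, 0, 1, 0], 2, [3, 2, 1], 7⟩,
   ⟨[2, 1, 0, 1, 2, 1], 4, [1, 3, 2, 1, 3, 2, 3, 2, 1, 3, 2, 3], 4⟩,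
   ⟨[2, 1, 0, 2, 1, 2, 1, 0, 1], 4, [1, 3, 2, 1, 2, 3, 2, 1, 2, 1, 2, 3], 4⟩,
   ⟨[0, 1, 0, 1, 0], 1, [1, 3], 1⟩,
   ⟨[0, 1, 0, 1, 0, 1], 1, [2, 3, 2, 1, 2, 3, 2, 1, 2, 3, 2, 3], 2⟩,
   ⟨[2, 1, 0, 1, 0, 1, 0, 1], 3, [3, 2, 3, 2, 3, 2, 3, 2, 3], 1⟩,
   ⟨[1, 0, 1, 0, 1, 0, 1, 0, 2], 3, [3, 2, 3, 2, 3, 2, 3, 2, 3], 1⟩,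
   ⟨[0, 1, 0, 1, 0, 1, 0, 1, 0], 1, [1, 3, 2, 3, 2, 3, 2, 3, 2], 3⟩,
   ⟨[1, 2, 3, 2, 1, 3, 2, 1, 2, 3, 2], 3, [4, 3, 2, 3, 2, 3, 2, 3, 2, 3, 4], 1⟩,
   ⟨[1, 0, 1, 2, 1, 0, 1, 2, 1, 0, 1, 0], 3, [2, 3, 2, 3, 2, 3, 2, 3, 2], 1⟩,
   ⟨[1, 0, 1, 0, 1, 2, 1, 0], 2, [1, 2, 1, 2, 3, 2], 5⟩,
   ⟨[0, 1, 0, 2, 1, 0, 1, 0, 2, 1, 0], 1, [1, 3, 2, 1, 3, 2, 3, 2, 1, 2, 1, 3], 3⟩,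
   ⟨[1, 0], 4, [1, 2, 3, 2, 3, 2], 7⟩,
   ⟨[1, 0, 1, 2, 1, 0, 1, 0], 6, [3, 2, 3, 2, 3, 2, 3, 2, 3, 2], 1⟩,
   ⟨[0, 1, 0, 2, 1, 0, 1, 0, 2, 1, 0, 2], 4, [2, 1, 2, 3, 2, 1], 4⟩,
   ⟨[0, 1, 0, 2, 1, 2, 1, 0, 2, 1, 0, 2], 3, [3, 2, 1, 3, 2, 3, 2], 6⟩,
   ⟨[1, 0, 1, 0, 2, 1, 0], 6, [1, 3, 2, 1, 3, 2, 1, 2, 1, 3, 2, 3], 3⟩,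
   ⟨[1, 2, 1, 0, 1, 0, 1, 0, 1, 2], 4, [1, 3, 2, 1, 2, 3, 2, 1, 2, 3], 4⟩,
   ⟨[0, 2, 1, 2, 1, 2, 1, 0, 1, 0, 1, 2], 4, [1, 2, 1, 3, 2, 3, 2, 1, 3, 2, 3], 4⟩,
   ⟨[0, 1, 0, 1, 0, 1, 0, 1, 0], 1, [3, 2, 1, 2, 1, 2], 3⟩,
   ⟨[0, 1, 2, 1, 2, 1], 3, [3, 2, 3, 2, 3, 2, 3, 2, 3], 1⟩,
   ⟨[1, 0, 1, 0, 1, 0, 1, 2], 3, [3, 2, 3, 2, 3], 1⟩,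
   ⟨[0, 1, 0, 1, 0, 1, 0, 1], 1, [1, 2, 1, 2, 1, 3, 2, 1, 3, 2, 1, 2], 2⟩,
   ⟨[2, 1, 2, 1, 0, 2, 1, 0, 2, 1, 2, 1], 2, [3, 2, 3, 2], 2⟩,
   ⟨[0, 1, 0, 1, 0, 1, 0, 1, 0], 1, [2, 1, 3, 2, 1, 3, 2, 3], 3⟩,
   ⟨[0, 1, 0, 2, 1, 0, 2, 1, 2, 1, 2], 2, [2, 3, 2, 3, 2, 3, 2, 3, 2, 1, 2, 1], 1⟩,
   ⟨[1, 2, 1, 0, 1, 0, 1, 0, 1, 2], 3, [3, 2, 3, 2, 1, 2, 3, 2, 3], 1⟩,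
   ⟨[0, 1, 2, 1, 0, 1, 2, 1, 0, 2], 3, [2, 3, 2, 3, 2, 1, 2, 3, 2, 1, 3], 1⟩,
   ⟨[2, 1, 0, 1, 2, 1, 0, 1, 2, 1], 2, [1, 2, 3, 2, 3, 2, 3, 2], 3⟩,
   ⟨[0, 1, 0, 1, 0, 1, 2, 1], 3, [1, 2, 1, 2, 3, 2, 1, 2, 3, 2], 2⟩,
   ⟨[2, 1, 0, 2, 1, 2, 1, 0, 1, 2, 1, 0], 2, [2, 1, 2, 3, 2, 1, 2, 1, 2, 3], 2⟩,
   ⟨[1, 2, 1, 0, 1, 2, 1, 2], 3, [3, 2, 1, 2, 3, 2], 4⟩,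
   ⟨[0, 1, 0, 1, 0, 1, 0, 1, 0, 1, 0], 1, [3, 2, 1, 2, 3, 2, 3, 2, 1, 2], 4⟩,
   ⟨[1, 2, 1, 0, 1, 0, 1, 2, 1, 0], 4, [3, 2, 3, 2, 3, 2, 3, 2, 3, 2, 3], 1⟩,
   ⟨[1, 0, 2, 1, 0, 1, 0, 1, 0, 2, 1, 2], 4, [1, 2, 3, 2, 1, 2], 2⟩,
   ⟨[1, 0, 1, 0, 2, 1, 0, 1, 0, 2, 1, 0], 5, [2, 3, 2, 1], 3⟩,
   ⟨[2, 1, 0, 1, 2, 1, 0, 1, 2, 1, 0, 1], 1, [3, 2, 1, 3, 2, 3, 2, 1, 3, 2, 3, 2], 5⟩,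
   ⟨[0, 1, 0, 2, 1, 2, 1, 0, 2, 1, 2, 1, 0], 1, [2, 3, 2, 1, 2, 1, 2, 3, 2, 1, 2, 1, 2, 1, 2, 1, 3,
      2, 1, 2, 1, 3, 2, 1, 2, 1, 2, 3, 2, 1, 2, 1, 2, 3, 2, 1, 2, 1, 2, 3, 2, 1, 2, 1, 3, 2, 1, 2,
      3], 1⟩]

/-- The only table reached by the search that does not violate the intersection property: it has
rank 4 and is the table of the graph `specialGraph`, whose vertices it names as in `specialName`. -/
def specialTable : ℕ := 0x98ba674532100000ab769853421000009ab854762310000097b6a8543120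

/-- A complete table is the exceptional one, in rank 4, or it violates the intersection property. -/
def leafTest (r : ℕ) (t : ℕ) : Bool :=
  cond (Nat.beq t specialTable) (Nat.beq r 4) (relations.any fun R => R.refutes r t)

section

variable {p : ℕ → Perm (Fin 11)} {r i : ℕ} {a b : Fin 11} {A : Set (Fin 11)}

namespace Consistent

variable {t n s : ℕ} {f : ℕ → Fin 11}

theorem wordValue_apply (C : Consistent p r i a b A t n s f) {u : List ℕ} (hu : ∀ j ∈ u, j < r)
    {x : ℕ} (hx : x ≤ n) (h : wordValue t u x ≠ 0) :
    x ≠ 0 ∧ wordValue t u x ≤ n ∧ (u.map p).prod (f x) = f (wordValue t u x) := by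
  induction u with
  | nil => exact ⟨h, hx, rfl⟩
  | cons j u ih =>
    change entry t j (wordValue t u x) ≠ 0 at h
    have hj := hu j List.mem_cons_self
    obtain ⟨h1, h2, h3⟩ := ih (fun k hk => hu k (List.mem_cons_of_mem _ hk))
      (C.ne_zero_of_entry hj h)
    have hn := C.le
    have he := C.entries j hj _ (h2.trans hn) h
    refine ⟨h1, he.2.2.2.1, ?_⟩
    rw [List.map_cons, List.prod_cons, Perm.mul_apply, h3]
    exact he.2.2.2.2.1

theorem powerValue_apply (C : Consistent p r i a b A t n s f) {u : List ℕ}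
    (hu : ∀ j ∈ u, j < r) (m : ℕ) {x : ℕ} (hx : x ≤ n) (h : powerValue t u m x ≠ 0) :
    x ≠ 0 ∧ powerValue t u m x ≤ n ∧ ((u.map p).prod ^ m) (f x) = f (powerValue t u m x) := by
  induction m with
  | zero => exact ⟨h, hx, rfl⟩
  | succ m ih =>
    change wordValue t u (powerValue t u m x) ≠ 0 at h
    have h0 : powerValue t u m x ≠ 0 := by
      by_contra h0
      by_cases hn0 : powerValue t u m x ≤ n
      · exact (C.wordValue_apply hu hn0 h).1 h0
      · omega
    obtain ⟨h1, h2, h3⟩ := ih h0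
    obtain ⟨-, h5, h6⟩ := C.wordValue_apply hu h2 h
    refine ⟨h1, h5, ?_⟩
    rw [pow_succ', Perm.mul_apply, h3, h6]
    rfl

theorem surjective (C : Consistent p r i a b A t 11 s f) (x : Fin 11) :
    ∃ v, 1 ≤ v ∧ v ≤ 11 ∧ f v = x := by
  have himg : (Finset.Icc 1 11).image f = Finset.univ := by
    apply Finset.eq_univ_of_card
    rw [Finset.card_image_of_injOn, Nat.card_Icc, Fintype.card_fin]
    intro u hu w hw huw
    rw [Finset.mem_coe, Finset.mem_Icc] at hu hw
    exact C.inj u w hu.1 hu.2 hw.1 hw.2 huw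
  obtain ⟨w, hw, hw'⟩ := Finset.mem_image.1 (himg ▸ Finset.mem_univ x)
  rw [Finset.mem_Icc] at hw
  exact ⟨w, hw.1, hw.2, hw'⟩

end Consistent

/-- The partial map `g` of names, with 0 for unknown values, describes the permutation `π`. -/
def Computes (f : ℕ → Fin 11) (π : Perm (Fin 11)) (g : ℕ → ℕ) : Prop :=
  ∀ x ≤ 11, g x ≠ 0 → x ≠ 0 ∧ g x ≤ 11 ∧ π (f x) = f (g x)

theorem Computes.comp {f : ℕ → Fin 11} {π τ : Perm (Fin 11)} {g h : ℕ → ℕ}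
    (hπ : Computes f π g) (hτ : Computes f τ h) (hz : ∀ x ≤ 11, h x ≤ 11) :
    Computes f (π * τ) (fun x => g (h x)) := by
  intro x hx h0
  have h1 := hπ (h x) (hz x hx) h0
  have h2 := hτ x hx h1.1
  exact ⟨h2.1, h1.2.1, by rw [Perm.mul_apply, h2.2.2, h1.2.2]⟩

theorem ne_of_differOnNames {t s : ℕ} {f : ℕ → Fin 11} (C : Consistent p r i a b A t 11 s f)
    {π τ : Perm (Fin 11)} {g h : ℕ → ℕ} (hπ : Computes f π g) (hτ : Computes f τ h)
    (hd : differOnNames g h = true) : π ≠ τ := by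
  rintro rfl
  rw [differOnNames, List.any_eq_true] at hd
  obtain ⟨x, hx, hd⟩ := hd
  rw [mem_names] at hx
  simp only [Bool.and_eq_true, Bool.not_eq_true', ← Bool.not_eq_true, Nat.beq_eq] at hd
  have h1 := hπ x hx.2 hd.1
  have h2 := hτ x hx.2 hd.2.1
  exact hd.2.2 (C.inj _ _ (by omega) h1.2.1 (by omega) h2.2.1 (h1.2.2.symm.trans h2.2.2))

/-- If the generators of a group invert `z`, then every element centralizes or inverts it. -/
theorem conj_eq_or_eq_inv_of_mem_closure {M : Type*} [Group M] {S : Set M} {z : M}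
    (hS : ∀ x ∈ S, x * z * x⁻¹ = z⁻¹) (y : M) (hy : y ∈ Subgroup.closure S) :
    y * z * y⁻¹ = z ∨ y * z * y⁻¹ = z⁻¹ := by
  have hflip : ∀ x : M, x * z⁻¹ * x⁻¹ = (x * z * x⁻¹)⁻¹ := fun x => by group
  induction hy using Subgroup.closure_induction with
  | mem x hx => exact Or.inr (hS x hx)
  | one => left; simp
  | mul x y _ _ hx hy =>
    have e : x * y * z * (x * y)⁻¹ = x * (y * z * y⁻¹) * x⁻¹ := by group
    rw [e]
    rcases hx with hx | hx <;> rcases hy with hy | hy <;> rw [hy]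
    · exact Or.inl hx
    · rw [hflip, hx]; exact Or.inr rfl
    · exact Or.inr hx
    · rw [hflip, hx, inv_inv]; exact Or.inl rfl
  | inv x _ hx =>
    have e : ∀ w : M, x⁻¹ * (x * w * x⁻¹) * x⁻¹⁻¹ = w := fun w => by group
    rcases hx with hx | hx
    · left
      have := e z
      rwa [hx] at this
    · right
      have := e z⁻¹
      rwa [hflip, hx, inv_inv] at this

theorem notMem_closure_of_escapes {t s : ℕ} {f : ℕ → Fin 11} (H : IsSmallSplit p r i a b A)
    (C : Consistent p r i a b A t 11 s f) {π : Perm (Fin 11)} {g : ℕ → ℕ}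
    (hπ : Computes f π g) (hg : ∀ x ≤ 11, g x ≤ 11) {l : List ℕ} (hl : ∀ j ∈ l, j < r)
    (he : escapes t g l = true) :
    π ∉ Subgroup.closure (p '' {j | j ∈ l}) := by
  have hid : Computes f 1 id := fun x hx h => ⟨h, hx, rfl⟩
  have hp : ∀ j < r, Computes f (p j) (entry t j) := fun j hj x hx h =>
    have he := C.entries j hj x hx h
    ⟨by omega, he.2.2.2.1, he.2.2.2.2.1⟩
  have hb : ∀ j < r, ∀ x ≤ 11, entry t j x ≤ 11 := fun j hj x hx => C.entry_le hj hx
  have hinv : ∀ j < r, p j * p j = 1 := fun j hj => Perm.ext fun x => H.involutive j hj x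
  match l with
  | [] =>
    have h1 := ne_of_differOnNames C hπ hid he
    simpa using h1
  | [c] =>
    have hc := hl c (by simp)
    rw [escapes, Bool.and_eq_true] at he
    have h1 := ne_of_differOnNames C hπ hid he.1
    have h2 := ne_of_differOnNames C hπ (hp c hc) he.2
    intro hmem
    have himage : p '' {j | j ∈ [c]} = {p c} := by simp
    rw [himage, ← Subgroup.zpowers_eq_closure] at hmem
    obtain ⟨k, hk⟩ := Subgroup.mem_zpowers_iff.1 hmem
    have h3 : (p c) ^ (2 : ℤ) = 1 := by rw [zpow_two, hinv c hc]
    rcases Int.even_or_odd' k with ⟨m, hm | hm⟩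
    · exact h1 (by rw [← hk, hm, zpow_mul, h3, one_zpow])
    · exact h2 (by rw [← hk, hm, zpow_add, zpow_mul, h3, one_zpow, one_mul, zpow_one])
  | [c, d] =>
    have hc := hl c (by simp)
    have hd := hl d (by simp)
    rw [escapes, Bool.and_eq_true] at he
    have hcd := (hp c hc).comp (hp d hd) (hb d hd)
    have hdc := (hp d hd).comp (hp c hc) (hb c hc)
    have hz : ∀ x ≤ 11, entry t c (entry t d x) ≤ 11 := fun x hx => hb c hc _ (hb d hd x hx)
    have h1 := ne_of_differOnNames C (hπ.comp hcd hz) (hcd.comp hπ hg) he.1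
    have h2 := ne_of_differOnNames C (hπ.comp hcd hz) (hdc.comp hπ hg) he.2
    -- Every element of the dihedral group conjugates the rotation to itself or its inverse.
    have hnorm : ∀ σ ∈ Subgroup.closure (p '' {j | j ∈ [c, d]}),
        σ * (p c * p d) = p c * p d * σ ∨ σ * (p c * p d) = p d * p c * σ := by
      have hcinv : (p c)⁻¹ = p c := inv_eq_of_mul_eq_one_left (hinv c hc)
      have hdinv : (p d)⁻¹ = p d := inv_eq_of_mul_eq_one_left (hinv d hd)
      have hrot : (p c * p d)⁻¹ = p d * p c := by rw [mul_inv_rev, hcinv, hdinv]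
      intro σ hσ
      have hconj := conj_eq_or_eq_inv_of_mem_closure (z := p c * p d) (by
        rintro _ ⟨j, hj, rfl⟩
        have hj : j = c ∨ j = d := by simpa using hj
        rcases hj with rfl | rfl
        · rw [hrot, hcinv, ← mul_assoc, hinv j hc, one_mul]
        · rw [hrot, hdinv, mul_assoc, mul_assoc, hinv j hd, mul_one]) σ hσ
      rw [hrot] at hconj
      exact hconj.imp mul_inv_eq_iff_eq_mul.1 mul_inv_eq_iff_eq_mul.1
    intro hmem
    rcases hnorm π hmem with h | h
    · exact h1 h
    · exact h2 h
  | _ :: _ :: _ :: _ => simp [escapes] at he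

/-- The hypothesis `hinter` is the intersection property, applied to an element that is a power of a
word in two ways. -/
theorem Relation.false_of_refutes {t s : ℕ} {f : ℕ → Fin 11} (H : IsSmallSplit p r i a b A)
    (C : Consistent p r i a b A t 11 s f)
    (hinter : ∀ u v : List ℕ, (∀ j ∈ u, j < r) → (∀ j ∈ v, j < r) → ∀ m n : ℕ,
      (u.map p).prod ^ m = (v.map p).prod ^ n →
        (u.map p).prod ^ m ∈ Subgroup.closure (p '' {j | j ∈ u ∧ j ∈ v}))
    {R : Relation} (hR : R.refutes r t = true) : False := by
  unfold Relation.refutes at hR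
  cases hs : sameOnNames (powerValue t R.left R.leftExp) (powerValue t R.right R.rightExp) with
  | false => simp [hs] at hR
  | true =>
    simp only [hs, cond_true, Bool.and_eq_true, every_iff, Nat.blt_eq] at hR
    obtain ⟨hu, hv, he⟩ := hR
    rw [sameOnNames, every_iff] at hs
    have hs' : ∀ x, 1 ≤ x → x ≤ 11 → powerValue t R.left R.leftExp x ≠ 0 ∧
        powerValue t R.left R.leftExp x = powerValue t R.right R.rightExp x := by
      intro x hx1 hx2
      have h1 := hs x (mem_names.2 ⟨hx1, hx2⟩)
      cases h0 : Nat.beq (powerValue t R.left R.leftExp x) 0 with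
      | true => simp [h0] at h1
      | false =>
        rw [h0] at h1
        exact ⟨fun h => by simp [h] at h0, Nat.eq_of_beq_eq_true h1⟩
    have hcomp : Computes f ((R.left.map p).prod ^ R.leftExp) (powerValue t R.left R.leftExp) :=
      fun x hx h => C.powerValue_apply hu _ hx h
    have hle : ∀ x ≤ 11, powerValue t R.left R.leftExp x ≤ 11 := by
      intro x hx
      by_cases h : powerValue t R.left R.leftExp x = 0
      · omega
      · exact (hcomp x hx h).2.1
    have heq : (R.left.map p).prod ^ R.leftExp = (R.right.map p).prod ^ R.rightExp := by
      ext1 y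
      obtain ⟨x, hx1, hx2, rfl⟩ := C.surjective y
      obtain ⟨h0, hxy⟩ := hs' x hx1 hx2
      rw [(C.powerValue_apply hu _ hx2 h0).2.2,
        (C.powerValue_apply hv _ hx2 (hxy ▸ h0)).2.2, hxy]
    refine notMem_closure_of_escapes H C hcomp hle (l := commonLetters r R.left R.right)
      (fun j hj => mem_labels.1 (List.mem_filter.1 hj).1) he ?_
    have hset : {j | j ∈ commonLetters r R.left R.right} = {j | j ∈ R.left ∧ j ∈ R.right} := by
      ext j
      simp only [commonLetters, List.mem_filter, Bool.and_eq_true, decide_eq_true_eq,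
        Set.mem_ofPred_eq, mem_labels]
      exact ⟨fun h => h.2, fun h => ⟨hu j h.1, h⟩⟩
    rw [hset]
    exact hinter _ _ hu hv _ _ heq

/-- Up to the naming `f` of the points, `p` is the representation with the table `specialTable`. -/
def IsExceptional (p : ℕ → Perm (Fin 11)) : Prop :=
  ∃ f : ℕ → Fin 11, (∀ u v, 1 ≤ u → u ≤ 11 → 1 ≤ v → v ≤ 11 → f u = f v → u = v) ∧
    ∀ j < 4, ∀ v, 1 ≤ v → v ≤ 11 → p j (f v) = f (entry specialTable j v)

theorem isExceptional_of_leafTest {t s : ℕ} {f : ℕ → Fin 11} (H : IsSmallSplit p r i a b A)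
    (C : Consistent p r i a b A t 11 s f)
    (hinter : ∀ u v : List ℕ, (∀ j ∈ u, j < r) → (∀ j ∈ v, j < r) → ∀ m n : ℕ,
      (u.map p).prod ^ m = (v.map p).prod ^ n →
        (u.map p).prod ^ m ∈ Subgroup.closure (p '' {j | j ∈ u ∧ j ∈ v}))
    (h : leafTest r t = true) : r = 4 ∧ IsExceptional p := by
  unfold leafTest at h
  cases ht : Nat.beq t specialTable with
  | true =>
    obtain rfl := Nat.eq_of_beq_eq_true ht
    rw [ht, cond_true] at h
    obtain rfl := Nat.eq_of_beq_eq_true h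
    refine ⟨rfl, f, C.inj, fun j hj v hv1 hv2 => C.apply hj hv2 ?_⟩
    have : ∀ j < 4, ∀ v < 12, 1 ≤ v → entry specialTable j v ≠ 0 := by decide
    exact this j hj v (by omega) hv1
  | false =>
    rw [ht, cond_false, List.any_eq_true] at h
    obtain ⟨R, -, hR⟩ := h
    exact (R.false_of_refutes H C hinter hR).elim

end

/-! ### The evaluation of the search -/

/-- The enumeration, for all ranks `r ≤ 5` and all labels `i` with `2 * i < r`. -/
theorem forall_searchFromStart_leafTest :
    ∀ q ∈ [(1, 0), (2, 0), (3, 0), (3, 1), (4, 0), (4, 1), (5, 0), (5, 1), (5, 2)],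
      searchFromStart q.1 q.2 (leafTest q.1) = true := by
  decide +kernel

theorem searchFromStart_leafTest {r i : ℕ} (hr : r ≤ 5) (hi : 2 * i < r) :
    searchFromStart r i (leafTest r) = true := by
  have hmem : (r, i) ∈
      [(1, 0), (2, 0), (3, 0), (3, 1), (4, 0), (4, 1), (5, 0), (5, 1), (5, 2)] := by
    simp only [List.mem_cons, Prod.mk.injEq, List.not_mem_nil, or_false]
    omega
  exact forall_searchFromStart_leafTest (r, i) hmem

theorem IsSplit.isExceptional {p : ℕ → Perm (Fin 11)} {r i : ℕ} {a b : Fin 11}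
    {A : Set (Fin 11)} (H : IsSplit p r i a b A) (hr : r ≤ 5) (hi : 2 * i < r)
    (hinter : ∀ u v : List ℕ, (∀ j ∈ u, j < r) → (∀ j ∈ v, j < r) → ∀ m n : ℕ,
      (u.map p).prod ^ m = (v.map p).prod ^ n →
        (u.map p).prod ^ m ∈ Subgroup.closure (p '' {j | j ∈ u ∧ j ∈ v})) :
    r = 4 ∧ IsExceptional p := by
  obtain ⟨a, b, A, H⟩ := H.exists_isSmallSplit
  exact searchFromStart_sound H
    (fun t s f C h => isExceptional_of_leafTest H C hinter h) (searchFromStart_leafTest hr hi)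

end SplitSearch

open Equiv
open scoped Pointwise

/-! ### Fracture graphs and splitting edges -/

/-- The generators as a family over all natural numbers; labels from `r` on give the identity. -/
def extendLabels {M : Type*} [One M] {r : ℕ} (ρ : Fin r → M) (j : ℕ) : M :=
  if h : j < r then ρ ⟨j, h⟩ else 1

theorem extendLabels_val {M : Type*} [One M] {r : ℕ} (ρ : Fin r → M) (j : Fin r) :
    extendLabels ρ j = ρ j := by
  simp [extendLabels]

theorem extendLabels_of_lt {M : Type*} [One M] {r : ℕ} (ρ : Fin r → M) {j : ℕ} (h : j < r) :
    extendLabels ρ j = ρ ⟨j, h⟩ := by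
  simp [extendLabels, h]

section

variable {G : Subgroup (Perm (Fin 11))} {r : ℕ} {ρ : Fin r → Perm (Fin 11)}

theorem IsSGGI.mul_self {M : Type*} [Group M] {G : Subgroup M} {ρ : Fin r → M}
    (hC : IsSGGI G ρ) (j : Fin r) : ρ j * ρ j = 1 := by
  rw [← pow_two, ← hC.involution j, pow_orderOf_eq_one]

theorem IsSGGI.apply_apply (hC : IsSGGI G ρ) (j : Fin r) (x : Fin 11) : ρ j (ρ j x) = x := by
  rw [← Perm.mul_apply, hC.mul_self, Perm.one_apply]

theorem IsSGGI.commute {M : Type*} [Group M] {G : Subgroup M} {ρ : Fin r → M}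
    (hC : IsSGGI G ρ) {j k : Fin r} (h : 1 < |(j : ℤ) - (k : ℤ)|) :
    ρ j * ρ k = ρ k * ρ j := by
  have h1 := hC.commuting j k h
  have hj := hC.mul_self j
  have hk := hC.mul_self k
  calc ρ j * ρ k = (ρ j * ρ k)⁻¹ := by
        rw [pow_two] at h1; exact eq_inv_of_mul_eq_one_left h1
    _ = ρ k * ρ j := by
        rw [mul_inv_rev, inv_eq_of_mul_eq_one_left hj, inv_eq_of_mul_eq_one_left hk]

theorem IsSGGI.mem {M : Type*} [Group M] {G : Subgroup M} {ρ : Fin r → M}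
    (hC : IsSGGI G ρ) (j : Fin r) : ρ j ∈ G := by
  rw [← hC.closure_eq]
  exact Subgroup.subset_closure ⟨j, rfl⟩

/-- A product of `n` disjoint transpositions is even if and only if `n` is. -/
theorem card_support_of_even {σ : Perm (Fin 11)} (ho : orderOf σ = 2)
    (he : σ ∈ alternatingGroup (Fin 11)) : σ.support.card = 4 ∨ σ.support.card = 8 := by
  obtain ⟨n, hn⟩ := Perm.cycleType_prime_order (σ := σ) (ho ▸ Nat.prime_two)
  rw [ho] at hn
  have hcard := σ.sum_cycleType
  have hle : σ.support.card ≤ 11 := by simpa using Finset.card_le_univ σ.support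
  have hsign := Perm.sign_of_cycleType σ
  rw [Perm.mem_alternatingGroup.1 he, hn] at hsign
  rw [hn] at hcard
  simp only [Multiset.sum_replicate, Multiset.card_replicate, smul_eq_mul] at hcard hsign
  have hn5 : n ≤ 4 := by omega
  interval_cases n
  · exact absurd hsign (by decide)
  · left; omega
  · exact absurd hsign (by decide)
  · right; omega
  · exact absurd hsign (by decide)

theorem apply_mem_orbit_iff {H : Subgroup (Perm (Fin 11))} {σ : Perm (Fin 11)} (hσ : σ ∈ H)
    (x y : Fin 11) : σ x ∈ MulAction.orbit H y ↔ x ∈ MulAction.orbit H y := by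
  rw [← MulAction.orbit_eq_iff, ← MulAction.orbit_eq_iff]
  have : MulAction.orbit H (σ x) = MulAction.orbit H x :=
    MulAction.orbit_smul (⟨σ, hσ⟩ : H) x
  rw [this]

theorem mem_maximalParabolic {M : Type*} [Group M] {ρ : Fin r → M} {i j : Fin r}
    (h : j ≠ i) : ρ j ∈ maximalParabolic ρ i :=
  Subgroup.subset_closure ⟨j, h, rfl⟩

/-- The `i`-edge from `a` to `b` joins two orbits of `G_i`, and no other `i`-edge does. -/
structure IsOnlyCrossingEdge (ρ : Fin r → Perm (Fin 11)) (i : Fin r) (a b : Fin 11) : Prop where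
  apply_eq : ρ i a = b
  notMem : b ∉ MulAction.orbit (maximalParabolic ρ i) a
  eq_or_eq : ∀ x, ρ i x ∉ MulAction.orbit (maximalParabolic ρ i) x → x = a ∨ x = b

/-- The orbits of `a` and `b` under `G_i` are the two parts of a split. -/
theorem IsOnlyCrossingEdge.isSplit (hC : IsSGGI G ρ)
    (htrans : MulAction.IsPretransitive G (Fin 11)) (heven : G ≤ alternatingGroup (Fin 11))
    {i : Fin r} {a b : Fin 11} (h : IsOnlyCrossingEdge ρ i a b) :
    SplitSearch.IsSplit (extendLabels ρ) r i a b
      (MulAction.orbit (maximalParabolic ρ i) a) where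
  lt := i.2
  involutive j hj x := by
    rw [extendLabels_of_lt ρ hj, hC.apply_apply]
  commute j hj k hk hf x := by
    rw [extendLabels_of_lt ρ hj, extendLabels_of_lt ρ hk, ← Perm.mul_apply, ← Perm.mul_apply,
      hC.commute]
    rw [SplitSearch.far_iff] at hf
    rw [lt_abs]
    push_cast
    omega
  support j hj := by
    rw [extendLabels_of_lt ρ hj]
    exact card_support_of_even (hC.involution _) (heven (hC.mem _))
  swap := by rw [extendLabels_val, h.apply_eq]
  left_mem := MulAction.mem_orbit_self a
  right_notMem := h.notMem
  mem_iff j hj hji x := by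
    rw [extendLabels_of_lt ρ hj]
    exact apply_mem_orbit_iff
      (mem_maximalParabolic fun e => hji (congrArg Fin.val e)) x a
  mem_iff_of_ne x ha hb := by
    rw [extendLabels_val, ← MulAction.orbit_eq_iff, ← MulAction.orbit_eq_iff]
    have hx : ρ i x ∈ MulAction.orbit (maximalParabolic ρ i) x := by
      by_contra hx
      exact (h.eq_or_eq x hx).elim ha hb
    rw [MulAction.orbit_eq_iff.2 hx]
  covers S ha hb hS := by
    set H := maximalParabolic ρ i with hH
    have hstab : H ≤ MulAction.stabilizer (Perm (Fin 11)) (S : Set (Fin 11)) := by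
      rw [hH, maximalParabolic, parabolic, Subgroup.closure_le]
      rintro _ ⟨j, hj, rfl⟩
      rw [SetLike.mem_coe, MulAction.mem_stabilizer_set]
      have hstep : ∀ x ∈ S, ρ j x ∈ S := fun x hx => by
        have := hS j j.2 (fun e => hj (Fin.ext e)) x hx
        rwa [extendLabels_val] at this
      intro x
      refine ⟨fun hx => ?_, hstep x⟩
      have := hstep _ hx
      rwa [Perm.smul_def, hC.apply_apply] at this
    have hsub : ∀ x ∈ S, ∀ y ∈ MulAction.orbit H x, y ∈ S := by
      rintro x hx _ ⟨σ, rfl⟩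
      exact (MulAction.mem_stabilizer_set.1 (hstab σ.2) x).2 hx
    have hswap : ρ i b = a := by rw [← h.apply_eq, hC.apply_apply]
    -- The union of the orbits of `a` and `b` is preserved by every generator, so by transitivity
    -- it is everything.
    have hstab' : G ≤ MulAction.stabilizer (Perm (Fin 11))
        (MulAction.orbit H a ∪ MulAction.orbit H b : Set (Fin 11)) := by
      rw [← hC.closure_eq, Subgroup.closure_le]
      rintro _ ⟨j, rfl⟩
      rw [SetLike.mem_coe, MulAction.mem_stabilizer_set]
      intro x
      rw [Perm.smul_def, Set.mem_union, Set.mem_union]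
      by_cases hj : j = i
      · subst hj
        by_cases hxa : x = a
        · subst hxa
          rw [h.apply_eq]
          simp [MulAction.mem_orbit_self]
        by_cases hxb : x = b
        · subst hxb
          rw [hswap]
          simp [MulAction.mem_orbit_self]
        have hx : ρ j x ∈ MulAction.orbit H x := by
          by_contra hx
          exact (h.eq_or_eq x hx).elim hxa hxb
        simp only [← MulAction.orbit_eq_iff] at hx ⊢
        rw [hx]
      · have hjH := mem_maximalParabolic (ρ := ρ) hj
        rw [apply_mem_orbit_iff hjH, apply_mem_orbit_iff hjH]
    refine Finset.eq_univ_iff_forall.2 fun x => ?_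
    obtain ⟨σ, hσ⟩ := htrans.exists_smul_eq a x
    have hx : x ∈ (MulAction.orbit H a ∪ MulAction.orbit H b : Set (Fin 11)) := by
      rw [← hσ]
      exact (MulAction.mem_stabilizer_set.1 (hstab' σ.2) a).2
        (Or.inl (MulAction.mem_orbit_self a))
    exact hx.elim (hsub a ha x) (hsub b hb x)

theorem prod_mem_parabolic (ρ : Fin r → Perm (Fin 11)) {u : List ℕ} (hu : ∀ j ∈ u, j < r) :
    (u.map (extendLabels ρ)).prod ∈ parabolic ρ {j | (j : ℕ) ∈ u} := by
  refine Subgroup.list_prod_mem _ fun σ hσ => ?_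
  obtain ⟨j, hj, rfl⟩ := List.mem_map.1 hσ
  rw [extendLabels_of_lt ρ (hu j hj)]
  exact Subgroup.subset_closure ⟨⟨j, hu j hj⟩, hj, rfl⟩

theorem IsStringCGroup.prod_pow_mem_closure (hC : IsStringCGroup G ρ) (u v : List ℕ)
    (hu : ∀ j ∈ u, j < r) (hv : ∀ j ∈ v, j < r) (m n : ℕ)
    (h : (u.map (extendLabels ρ)).prod ^ m = (v.map (extendLabels ρ)).prod ^ n) :
    (u.map (extendLabels ρ)).prod ^ m ∈
      Subgroup.closure (extendLabels ρ '' {j | j ∈ u ∧ j ∈ v}) := by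
  have h1 : (u.map (extendLabels ρ)).prod ^ m ∈
      parabolic ρ {j | (j : ℕ) ∈ u} ⊓ parabolic ρ {j | (j : ℕ) ∈ v} :=
    ⟨pow_mem (prod_mem_parabolic ρ hu) m, h ▸ pow_mem (prod_mem_parabolic ρ hv) n⟩
  rw [hC.intersection] at h1
  refine Subgroup.closure_mono ?_ h1
  rintro _ ⟨j, hj, rfl⟩
  exact ⟨j, hj, extendLabels_val ρ j⟩

/-- If every label has two edges that join different orbits, then these form a 2-fracture graph. -/
theorem HasFractureGraph.hasTwoFractureGraph_or (hF : HasFractureGraph ρ) :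
    HasTwoFractureGraph ρ ∨ ∃ i a b, IsOnlyCrossingEdge ρ i a b := by
  rw [or_iff_not_imp_right]
  intro hno
  obtain ⟨F, hF⟩ := hF
  have hcross : ∀ i, ∃ a, ρ i a ∉ MulAction.orbit (maximalParabolic ρ i) a := by
    intro i
    obtain ⟨hle, hcr, hcard⟩ := hF i
    have hne : (F i).edgeSet.Nonempty := by
      rw [← Set.encard_ne_zero, hcard]
      simp
    obtain ⟨e, he⟩ := hne
    induction e using Sym2.ind with
    | _ a b =>
      rw [SimpleGraph.mem_edgeSet] at he
      have h1 := hle he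
      rw [permRepGraph, SimpleGraph.fromRel_adj] at h1
      rcases h1.2 with h2 | h2
      · exact ⟨a, h2 ▸ hcr b a he.symm⟩
      · exact ⟨b, h2 ▸ hcr a b he⟩
  choose a ha using hcross
  have hsecond : ∀ i, ∃ x, ρ i x ∉ MulAction.orbit (maximalParabolic ρ i) x ∧
      x ≠ a i ∧ x ≠ ρ i (a i) := by
    intro i
    by_contra hcon
    push Not at hcon
    refine hno ⟨i, a i, ρ i (a i), rfl, ha i, fun x hx => ?_⟩
    by_contra hne
    push Not at hne
    exact hne.2 (hcon x hx hne.1)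
  choose x hx hxa hxb using hsecond
  have hnd : ∀ i y, ρ i y ∉ MulAction.orbit (maximalParabolic ρ i) y → y ≠ ρ i y :=
    fun i y hy he => hy (by rw [← he]; exact MulAction.mem_orbit_self y)
  refine ⟨fun i => SimpleGraph.fromEdgeSet {s(a i, ρ i (a i)), s(x i, ρ i (x i))},
    fun i => ⟨?_, ?_, ?_⟩⟩
  · intro u v huv
    rw [SimpleGraph.fromEdgeSet_adj] at huv
    rw [permRepGraph, SimpleGraph.fromRel_adj]
    refine ⟨huv.2, ?_⟩
    rcases huv.1 with h | h <;> rcases Sym2.eq_iff.1 h with ⟨rfl, rfl⟩ | ⟨rfl, rfl⟩ <;> simp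
  · intro u v huv
    rw [SimpleGraph.fromEdgeSet_adj] at huv
    have key : ∀ y, ρ i y ∉ MulAction.orbit (maximalParabolic ρ i) y → s(u, v) = s(y, ρ i y) →
        u ∉ MulAction.orbit (maximalParabolic ρ i) v := by
      intro y hy h
      rcases Sym2.eq_iff.1 h with ⟨rfl, rfl⟩ | ⟨rfl, rfl⟩
      · rwa [MulAction.mem_orbit_symm]
      · exact hy
    rcases huv.1 with h | h
    · exact key _ (ha i) h
    · exact key _ (hx i) h
  · rw [SimpleGraph.edgeSet_fromEdgeSet]
    have hdiag : ({s(a i, ρ i (a i)), s(x i, ρ i (x i))} : Set (Sym2 (Fin 11))) \ Sym2.diagSet =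
        {s(a i, ρ i (a i)), s(x i, ρ i (x i))} := by
      rw [sdiff_eq_left, Set.disjoint_left]
      rintro e (rfl | rfl) he
      · exact hnd i _ (ha i) (by simpa using he)
      · exact hnd i _ (hx i) (by simpa using he)
    rw [hdiag, Set.encard_pair]
    · rfl
    · intro he
      rcases Sym2.eq_iff.1 he with h | h
      · exact hxa i h.1.symm
      · exact hxb i h.2.symm

/-! ### Duality -/

theorem LabelledGraph.Isomorphic.congr_dual {s : ℕ} {Ω Ω' : Type*} {𝒢 : LabelledGraph r Ω}
    {ℋ : LabelledGraph s Ω'} (h : Isomorphic 𝒢.dual ℋ) : Isomorphic 𝒢 ℋ.dual := by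
  obtain ⟨rfl, σ, hσ⟩ := h
  refine ⟨rfl, σ, fun i x y => ?_⟩
  have := hσ i.rev x y
  rwa [dual, Fin.rev_rev] at this

theorem parabolic_comp_rev {M : Type*} [Group M] (ρ : Fin r → M) (J : Set (Fin r)) :
    parabolic (ρ ∘ Fin.rev) J = parabolic ρ (Fin.rev '' J) := by
  rw [parabolic, parabolic, Set.image_comp]

theorem IsStringCGroup.comp_rev {M : Type*} [Group M] {G : Subgroup M} {ρ : Fin r → M}
    (hC : IsStringCGroup G ρ) : IsStringCGroup G (ρ ∘ Fin.rev) where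
  closure_eq := by
    rw [Fin.rev_surjective.range_comp, hC.closure_eq]
  injective := hC.injective.comp Fin.rev_injective
  involution i := hC.involution _
  commuting i j h := by
    refine hC.commuting _ _ ?_
    rw [Fin.val_rev, Fin.val_rev]
    have := i.2
    have := j.2
    rw [lt_abs] at h ⊢
    omega
  intersection J K := by
    rw [parabolic_comp_rev, parabolic_comp_rev, parabolic_comp_rev, hC.intersection,
      Set.image_inter Fin.rev_injective]

theorem maximalParabolic_comp_rev {M : Type*} [Group M] (ρ : Fin r → M) (i : Fin r) :
    maximalParabolic (ρ ∘ Fin.rev) i.rev = maximalParabolic ρ i := by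
  rw [maximalParabolic, maximalParabolic, parabolic_comp_rev]
  congr 1
  ext j
  constructor
  · rintro ⟨k, hk, rfl⟩ h
    exact hk (by rw [← h, Fin.rev_rev])
  · intro h
    exact ⟨j.rev, fun e => h (Fin.rev_injective e), Fin.rev_rev j⟩

theorem IsOnlyCrossingEdge.comp_rev {i : Fin r} {a b : Fin 11} (h : IsOnlyCrossingEdge ρ i a b) :
    IsOnlyCrossingEdge (ρ ∘ Fin.rev) i.rev a b := by
  constructor
  · simpa using h.apply_eq
  · rw [maximalParabolic_comp_rev]
    exact h.notMem
  · rw [maximalParabolic_comp_rev]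
    simpa using h.eq_or_eq

/-! ### The exceptional graph -/

/-- The names of the vertices of `specialGraph` in `specialTable`. -/
def specialName : Fin 11 → ℕ := ![1, 2, 3, 4, 6, 8, 5, 7, 10, 9, 11]

theorem isomorphic_specialGraph {ρ : Fin 4 → Perm (Fin 11)}
    (h : SplitSearch.IsExceptional (extendLabels ρ)) :
    LabelledGraph.Isomorphic (permRepGraph ρ) specialGraph := by
  obtain ⟨f, hinj, hf⟩ := h
  have hname : ∀ k, 1 ≤ specialName k ∧ specialName k ≤ 11 := by decide
  have hle : ∀ (j : Fin 4) k, 1 ≤ SplitSearch.entry SplitSearch.specialTable j (specialName k) ∧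
      SplitSearch.entry SplitSearch.specialTable j (specialName k) ≤ 11 := by
    decide
  have hentry : ∀ (j : Fin 4) (k l : Fin 11),
      (specialGraph j).Adj k l ↔
        k ≠ l ∧ SplitSearch.entry SplitSearch.specialTable j (specialName k) = specialName l := by
    intro j
    fin_cases j <;> simp only [specialGraph, Fin.zero_eta, Fin.mk_one, Fin.reduceFinMk,
      Matrix.cons_val, SimpleGraph.fromEdgeSet_adj, Set.mem_insert_iff,
      Set.mem_singleton_iff, Sym2.eq_iff] <;> decide
  have hg : Function.Injective (f ∘ specialName) := by
    intro k l hkl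
    have h1 := hinj _ _ (hname k).1 (hname k).2 (hname l).1 (hname l).2 hkl
    exact (by decide : Function.Injective specialName) h1
  have happly : ∀ (j : Fin 4) (k l : Fin 11), ρ j (f (specialName k)) = f (specialName l) ↔
      SplitSearch.entry SplitSearch.specialTable j (specialName k) = specialName l := by
    intro j k l
    rw [← extendLabels_val ρ j, hf j j.2 _ (hname k).1 (hname k).2]
    exact ⟨hinj _ _ (hle j k).1 (hle j k).2 (hname l).1 (hname l).2, congrArg f⟩
  let e : Fin 11 ≃ Fin 11 := Equiv.ofBijective _ (Finite.injective_iff_bijective.1 hg)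
  have hadj : ∀ (j : Fin 4) (k l : Fin 11),
      (permRepGraph ρ j).Adj (e k) (e l) ↔ (specialGraph j).Adj k l := by
    intro j k l
    have hsymm := (specialGraph j).adj_comm k l
    rw [hentry, hentry] at hsymm
    rw [permRepGraph, SimpleGraph.fromRel_adj, e.injective.ne_iff, hentry]
    change k ≠ l ∧ (ρ j (f (specialName k)) = f (specialName l) ∨
      ρ j (f (specialName l)) = f (specialName k)) ↔ _
    rw [happly, happly]
    tauto
  refine ⟨rfl, e.symm, fun j x y => ?_⟩
  rw [Fin.cast_eq_self, ← hadj, e.apply_symm_apply, e.apply_symm_apply]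

end

end StringC

theorem mainTheorem3 (G : Subgroup (Equiv.Perm (Fin 11)))
    (htrans : MulAction.IsPretransitive G (Fin 11))
    (heven : G ≤ alternatingGroup (Fin 11))
    (r : ℕ) (hr : r ≤ 5) (ρ : Fin r → Equiv.Perm (Fin 11))
    (hC : StringC.IsStringCGroup G ρ)
    (hF : StringC.HasFractureGraph ρ) :
    StringC.HasTwoFractureGraph ρ ∨
      StringC.LabelledGraph.Isomorphic (StringC.permRepGraph ρ) StringC.specialGraph ∨
      StringC.LabelledGraph.Isomorphic (StringC.permRepGraph ρ) StringC.specialGraph.dual := by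
  obtain h2 | ⟨i, a, b, h⟩ := hF.hasTwoFractureGraph_or
  · exact Or.inl h2
  right
  rcases Nat.lt_or_ge (2 * i) r with hi | hi
  · obtain ⟨rfl, hspecial⟩ := (h.isSplit hC.toIsSGGI htrans heven).isExceptional hr hi
      hC.prod_pow_mem_closure
    exact Or.inl (StringC.isomorphic_specialGraph hspecial)
  · have hi' : 2 * (i.rev : ℕ) < r := by
      have := i.2
      rw [Fin.val_rev]
      omega
    have hC' := hC.comp_rev
    obtain ⟨rfl, hspecial⟩ := (h.comp_rev.isSplit hC'.toIsSGGI htrans heven).isExceptional hr hi'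
      hC'.prod_pow_mem_closure
    exact Or.inr (StringC.LabelledGraph.Isomorphic.congr_dual
      (StringC.isomorphic_specialGraph hspecial))
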